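/- **Setting.** Let $\mathcal X\subset\mathbb R^d$ be a finite set of $k$ actions that spans $\mathbb R^d$, with $\operatorname{diam}(\mathcal X)\le 1$ and $\|x\|\le L$ for all $x\in\mathcal X$. Let $\mathcal M\subset\mathbb R^d$ be a known convex polytope with $\operatorname{diam}(\mathcal M)\le 1$, and let $\theta^*\in\mathcal M$ be the unknown parameter, with $\|\theta^*\|\le 1$. In round $t=1,2,\dots$ the learner plays $x_t\in\mathcal X$ and observes $y_t=\langle x_t,\theta^*\rangle+\epsilon_t$, where, given the past actions and rewards and $x_t$, the noise is $1$-subgaussian (for instance independent standard Gaussian). The expected regret is $R_n=\mathbb E\big[\max_{x\in\mathcal X}\sum_{t=1}^n\langle x-x_t,\theta^*\rangle\big]$. **Algorithm (frequentist IDS).** A counter $s$ starts at $1$. With the data $(x_i,y_i)_{i<s}$ of the previous exploration rounds put $V_s=\mathbf 1_d+\sum_{i<s}x_ix_i^\top$, $\hat\theta_s=V_s^{-1}\sum_{i<s}x_iy_i$, $\hat x_s\in\arg\max_{x\in\mathcal X}\langle x,\hat\theta_s\rangle$, $\beta_{s,c}=\big(\sqrt{2\log\max(c,1)+\log\det V_s}+1\big)^2$,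 $\|v\|_A^2=\langle v,Av\rangle$ and $$\hat\Delta_s(x)=\max_{z\in\mathcal X}\big(\langle z,\hat\theta_s\rangle+\beta_{s,s^2}^{1/2}\|z\|_{V_s^{-1}}\big)-\langle x,\hat\theta_s\rangle .$$ For $z\in\mathcal X\setminus\{\hat x_s\}$ let $\hat\nu_s(z)$ minimize $\|\nu-\hat\theta_s\|_{V_s}$ over $\{\nu\in\mathcal M:\langle z-\hat x_s,\nu\rangle\ge 0\}$; if this set is empty, the distance is taken to be $\infty$. Let $m_s=\min_{z\ne\hat x_s}\frac12\|\hat\nu_s(z)-\hat\theta_s\|_{V_s}^2$ (with $\min\emptyset=\infty$), let $q_s$ be the probability weights on $\mathcal X\setminus\{\hat x_s\}$ proportional to $\exp\big(-\frac{\eta_s}2\|\hat\nu_s(z)-\hat\theta_s\|_{V_s}^2\big)$, and $$I_s(x)=\tfrac12\sum_{z\neq\hat x_s}q_s(z)\big(|\langle\hat\nu_s(z)-\hat\theta_s,x\rangle|+\beta_{s,s^2}^{1/2}\|x\|_{V_s^{-1}}\big)^2 ,$$ where terms with infinite distance are omitted. The learning rate $\eta_s>0$ is a function of the data with $\log(k)/\eta_s\le\kappa\,(1+\max_{l\le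 s}m_l^{1/2})$ for a fixed $\kappa$. In round $t$, if $m_s\ge\frac12\beta_{s,t\log t}$, the algorithm plays $\hat x_s$ and discards the observation. Otherwise it samples $x_s\sim\mu_s$, where $\mu_s$ is a minimizer over the probability distributions $\mu$ on $\mathcal X$ of $\hat\Delta_s(\mu)^2/I_s(\mu)$ (here $f(\mu)=\sum_x\mu(x)f(x)$, $0/0=0$, and $a/0=\infty$ for $a>0$), stores $(x_s,y_s)$, and increases $s$ by one. Ties are broken arbitrarily (measurably). **Theorem (worst-case regret).** For all $\kappa, L$ there is a constant $C$, depending only on $\kappa$ and $L$, such that for all $d$, $\mathcal X$, $\mathcal M$, $\theta^*$ and all noise distributions as above, the regret of this algorithm satisfies $$R_n\le C\,d\sqrt n\,\log n\qquad\text{for all } n\ge 2 .$$ -/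

import Mathlib

open MeasureTheory
open scoped ENNReal Matrix

noncomputable section

namespace LinBandit

/-- Feature space `ℝ^d` with the Euclidean norm and inner product. -/
abbrev Vec (d : ℕ) : Type := EuclideanSpace ℝ (Fin d)

/-- Data collected in the exploration rounds: the list of pairs (action, reward), oldest first.
A list with `s - 1` entries is the data available at local time `s`. -/
abbrev Data (d : ℕ) : Type := List (Vec d × ℝ)

variable {d : ℕ}

/-- The local time `s` (counter of exploration steps, starting from `1`). -/
def localTime (D : Data d) : ℕ := D.length + 1

/-- Regularized covariance matrix `V_s = 1 + ∑ x_i x_iᵀ`. -/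
def cov (D : Data d) : Matrix (Fin d) (Fin d) ℝ :=
  1 + (D.map fun p => Matrix.vecMulVec p.1.ofLp p.1.ofLp).sum

/-- The matrix norm `‖v‖_A = √⟨v, A v⟩`. -/
def wnorm (A : Matrix (Fin d) (Fin d) ℝ) (v : Vec d) : ℝ :=
  Real.sqrt (v.ofLp ⬝ᵥ (A *ᵥ v.ofLp))

/-- Regularized least squares estimate `V_s⁻¹ ∑ x_i y_i`. -/
def thetaHat (D : Data d) : Vec d :=
  WithLp.toLp 2 ((cov D)⁻¹ *ᵥ (D.map fun p => p.2 • p.1.ofLp).sum)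

/-- Confidence coefficient `β_{s,c} = (√(2 log c + log det V_s) + 1)²` at level `c = 1/δ`.
Levels `c < 1` are read as `c = 1`; this matters only for `c = t log t` in round `t = 1`. -/
def beta (D : Data d) (c : ℝ) : ℝ :=
  (Real.sqrt (2 * Real.log (max c 1) + Real.log (cov D).det) + 1) ^ 2

/-- `β_{s,s²}^{1/2}`. -/
def radius (D : Data d) : ℝ := Real.sqrt (beta D ((localTime D : ℝ) ^ 2))

/-- Gap estimate
`(max_{z ∈ X} ⟨z, θ̂_s⟩ + β_{s,s²}^{1/2} ‖z‖_{V_s⁻¹}) - ⟨x, θ̂_s⟩`. -/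
def gapEst (X : Finset (Vec d)) (D : Data d) (x : Vec d) : ℝ :=
  (⨆ z : X, (inner ℝ (z : Vec d) (thetaHat D) + radius D * wnorm (cov D)⁻¹ (z : Vec d)))
    - inner ℝ x (thetaHat D)

/-- Parameters in `M` for which the reward of `z` is at least the reward of `x`. -/
def altSet (M : Set (Vec d)) (x z : Vec d) : Set (Vec d) :=
  {ν | ν ∈ M ∧ 0 ≤ inner ℝ (z - x) ν}

open Classical in
/-- Actions `z ≠ x` that are at least as good as `x` for some parameter in `M`. For the other
actions the closest alternative parameter is at distance `∞` and has weight `exp (-∞) = 0`. -/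
def alts (X : Finset (Vec d)) (M : Set (Vec d)) (x : Vec d) : Finset (Vec d) :=
  X.filter fun z => z ≠ x ∧ (altSet M x z).Nonempty

/-- Closest alternative parameter `ν̂_s(z)`: the minimizer of `‖ν - θ̂_s‖_{V_s}` over
`altSet M x z`, where `x` is the empirically best action. -/
def nuHat (M : Set (Vec d)) (D : Data d) (x z : Vec d) : Vec d :=
  Classical.epsilon fun ν => ν ∈ altSet M x z ∧
    ∀ ν' ∈ altSet M x z,
      wnorm (cov D) (ν - thetaHat D) ≤ wnorm (cov D) (ν' - thetaHat D)

/-- `½ ‖ν̂_s(z) - θ̂_s‖²_{V_s}`. -/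
def altCost (M : Set (Vec d)) (D : Data d) (x z : Vec d) : ℝ :=
  wnorm (cov D) (nuHat M D x z - thetaHat D) ^ 2 / 2

/-- `m_s = min_{z ≠ x} ½ ‖ν̂_s(z) - θ̂_s‖²_{V_s}`, equal to `∞` if there is no alternative. -/
def minCost (X : Finset (Vec d)) (M : Set (Vec d)) (D : Data d) (x : Vec d) : ℝ≥0∞ :=
  ⨅ z ∈ alts X M x, ENNReal.ofReal (altCost M D x z)

/-- Mixing weights, `q_s(z) ∝ exp (-(η/2) ‖ν̂_s(z) - θ̂_s‖²_{V_s})` on the alternatives. -/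
def qWeight (X : Finset (Vec d)) (M : Set (Vec d)) (D : Data d) (x : Vec d) (η : ℝ)
    (z : Vec d) : ℝ :=
  Real.exp (-η * altCost M D x z) / ∑ z' ∈ alts X M x, Real.exp (-η * altCost M D x z')

/-- Information gain `I_s(y)`. -/
def infoGain (X : Finset (Vec d)) (M : Set (Vec d)) (D : Data d) (x : Vec d) (η : ℝ)
    (y : Vec d) : ℝ :=
  (1 / 2) * ∑ z ∈ alts X M x, qWeight X M D x η z *
    (|inner ℝ (nuHat M D x z - thetaHat D) y| + radius D * wnorm (cov D)⁻¹ y) ^ 2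

/-- Information ratio `Ψ_s(μ) = Δ̂_s(μ)² / I_s(μ)` of a distribution `μ` on `X`, with values in
`[0, ∞]`: here `a / 0 = ∞` for `a > 0` and `0 / 0 = 0`. -/
def infoRatio (X : Finset (Vec d)) (M : Set (Vec d)) (D : Data d) (x : Vec d) (η : ℝ)
    (μ : X → ℝ) : ℝ≥0∞ :=
  ENNReal.ofReal ((∑ y : X, μ y * gapEst X D y) ^ 2) /
    ENNReal.ofReal (∑ y : X, μ y * infoGain X M D x η y)

/-- The choices made by the algorithm as functions of the exploration data: the empirically best
action (any tie-breaking), the learning rate, and the IDS distribution (any minimizer).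
The learning rate `η_s` may be any positive number with
`log k / η_s ≤ κ (1 + max_{l ≤ s} m_l^{1/2})`, where `k = |X|`. -/
structure IDS (X : Finset (Vec d)) (M : Set (Vec d)) (κ : ℝ) where
  xHat : Data d → X
  xHat_max : ∀ D, ∀ x ∈ X, inner ℝ x (thetaHat D) ≤ inner ℝ (xHat D : Vec d) (thetaHat D)
  eta : Data d → ℝ
  eta_pos : ∀ D, 0 < eta D
  eta_rate : ∀ D, ∃ l ≤ D.length, Real.log X.card ≤
    eta D * (κ * (1 + Real.sqrt (minCost X M (D.take l) (xHat (D.take l))).toReal))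
  mu : Data d → X → ℝ
  mu_mem : ∀ D, mu D ∈ stdSimplex ℝ X
  mu_min : ∀ D, ∀ μ' ∈ stdSimplex ℝ X,
    infoRatio X M D (xHat D) (eta D) (mu D) ≤ infoRatio X M D (xHat D) (eta D) μ'

variable {X : Finset (Vec d)} {M : Set (Vec d)} {κ : ℝ}

/-- Exploitation condition `m_s ≥ ½ β_{s, t log t}` in round `t`. -/
def IDS.Exploits (π : IDS X M κ) (t : ℕ) (D : Data d) : Prop :=
  ENNReal.ofReal (beta D (t * Real.log t) / 2) ≤ minCost X M D (π.xHat D)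

open Classical in
/-- Exploration data after the first `t` rounds, if `h i` is the pair (action, reward) of round
`i + 1`; pairs from exploitation rounds are discarded. -/
def IDS.data (π : IDS X M κ) (h : ℕ → Vec d × ℝ) : ℕ → Data d
  | 0 => []
  | t + 1 =>
    if π.Exploits (t + 1) (π.data h t) then π.data h t else π.data h t ++ [h t]

open Classical in
/-- Distribution of the action played in round `t` given the exploration data: a point mass at the
empirically best action in exploitation rounds, the IDS distribution in exploration rounds. -/
def IDS.actionLaw (π : IDS X M κ) (t : ℕ) (D : Data d) : X → ℝ :=
  if π.Exploits t D then Pi.single (π.xHat D) 1 else π.mu D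

variable {Ω : Type*}

/-- Pair (action, reward) of round `i + 1`, where the reward is `⟨x, θ⟩ + ε`. -/
def outcome (θ : Vec d) (A : ℕ → Ω → Vec d) (ε : ℕ → Ω → ℝ) (i : ℕ) (ω : Ω) : Vec d × ℝ :=
  (A i ω, inner ℝ (A i ω) θ + ε i ω)

/-- The `σ`-algebra generated by the actions and rewards of the first `t` rounds. -/
abbrev hist (θ : Vec d) (A : ℕ → Ω → Vec d) (ε : ℕ → Ω → ℝ) (t : ℕ) : MeasurableSpace Ω :=
  ⨆ i ∈ Finset.range t, MeasurableSpace.comap (outcome θ A ε i) inferInstance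

/-- Interaction of the algorithm `π` with the linear bandit with parameter `θ`: `A t` is the action
and `ε t` the noise of round `t + 1`. Given the past, the action has the law prescribed by the
algorithm; given the past and the action, the noise is `1`-subgaussian. -/
structure IsRun [MeasurableSpace Ω] (π : IDS X M κ) (θ : Vec d) (P : Measure Ω)
    (A : ℕ → Ω → Vec d) (ε : ℕ → Ω → ℝ) : Prop where
  measurable_action : ∀ t, Measurable (A t)
  measurable_noise : ∀ t, Measurable (ε t)
  measurable_xHat : ∀ t, Measurable[hist θ A ε t]
    fun ω => (π.xHat (π.data (fun i => outcome θ A ε i ω) t) : Vec d)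
  action_law : ∀ t, ∀ x : X,
    P[(A t ⁻¹' {(x : Vec d)}).indicator (fun _ => (1 : ℝ)) | hist θ A ε t] =ᵐ[P]
      fun ω => π.actionLaw (t + 1) (π.data (fun i => outcome θ A ε i ω) t) x
  noise_integrable : ∀ t, ∀ r : ℝ, Integrable (fun ω => Real.exp (r * ε t ω)) P
  noise_subgaussian : ∀ t, ∀ r : ℝ,
    P[fun ω => Real.exp (r * ε t ω) |
      hist θ A ε t ⊔ MeasurableSpace.comap (A t) inferInstance] ≤ᵐ[P]
      fun _ => Real.exp (r ^ 2 / 2)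

/-- Regret after `n` rounds along a trajectory, `max_{x ∈ X} ∑_{t ≤ n} ⟨x - x_t, θ⟩`. -/
def pathRegret (X : Finset (Vec d)) (θ : Vec d) (A : ℕ → Ω → Vec d) (n : ℕ) (ω : Ω) : ℝ :=
  ⨆ x : X, ∑ t ∈ Finset.range n, inner ℝ ((x : Vec d) - A t ω) θ

end LinBandit

end

open LinBandit

open MeasureTheory
open scoped ENNReal Matrix

noncomputable section

namespace LinBandit

/-! ### Weighted norms and rank-one updates of positive definite matrices. -/

section LinearAlgebra

variable {d : ℕ} {V : Matrix (Fin d) (Fin d) ℝ}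

/-! Each round is an exploitation or an exploration round, with or without a correct confidence set,
and the regret is split accordingly.

Confidence. Write `S` for `noiseSum` and `V` for `cov`. Then `mix`, that is `det(V)^{-1/2}
exp(‖S‖²_{V⁻¹}/2)`, is a supermartingale started at 1, because it mixes the subgaussian exponentials
over a Gaussian prior (`lintegral_mul_mixStep_le`). By Markov's inequality it reaches `c` with
probability at most `1/c`; below `c ≥ 1`, `θ` lies within `√β_c` of the estimate
(`wnorm_sub_thetaHat_lt`). Exploitation failures are counted by rounds at level `t log t`,
exploration failures by local time at level `s²`. A harmonic sum bounds their expected total by `9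
log n`.

Exploitation. If some action beat the played one, `θ` itself would be an alternative of cost below
`β/2`, contradicting the exploitation test. So a correct confidence set gives no positive regret
(`inner_le_of_exploits`).

Exploration. The UCB action has information ratio at most 2, hence so has the IDS distribution
(`sq_sum_gapEst_le`). The information gain of `x` is at most `K ‖x‖²_{V⁻¹}`, where `K` is of order
`d log n`: the Gibbs weights have mean cost at most `m_s + log k / η_s`, and failing the
exploitation test keeps every relevant `m_l` below `β/2` (`infoGain_le`, `minCost_take_le`). AM-GM
with a deterministic `c` bounds the conditional regret by `c/2` plus `O(K/c)` times the mean
potential `‖x‖²_{V⁻¹}`. The potentials of the played actions sum pathwise to `O(log det V) = O(d log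
n)` (`sum_potential_le`). The choice `c = d log n / √n` balances both contributions at order `d √n
log n`. -/

theorem dotProduct_mulVec_symm (hV : V.IsHermitian) (u v : Fin d → ℝ) :
    u ⬝ᵥ V *ᵥ v = v ⬝ᵥ V *ᵥ u := by
  have hT : Vᵀ = V := by simpa [Matrix.IsHermitian, Matrix.conjTranspose_eq_transpose_of_trivial] using hV
  rw [Matrix.dotProduct_mulVec, ← Matrix.mulVec_transpose, hT, dotProduct_comm]

theorem quad_nonneg (hV : V.PosSemidef) (u : Fin d → ℝ) : 0 ≤ u ⬝ᵥ V *ᵥ u := by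
  simpa using hV.dotProduct_mulVec_nonneg u

theorem quad_add (hV : V.IsHermitian) (u v : Fin d → ℝ) :
    (u + v) ⬝ᵥ V *ᵥ (u + v) = u ⬝ᵥ V *ᵥ u + 2 * (u ⬝ᵥ V *ᵥ v) + v ⬝ᵥ V *ᵥ v := by
  rw [Matrix.mulVec_add, add_dotProduct, dotProduct_add, dotProduct_add,
    dotProduct_mulVec_symm hV v u]
  ring

/-- Cauchy-Schwarz inequality for a positive semidefinite matrix. -/
theorem dotProduct_mulVec_sq_le (hV : V.PosSemidef) (u v : Fin d → ℝ) :
    (u ⬝ᵥ V *ᵥ v) ^ 2 ≤ (u ⬝ᵥ V *ᵥ u) * (v ⬝ᵥ V *ᵥ v) := by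
  have h := LinearMap.BilinForm.apply_mul_apply_le_of_forall_zero_le (Matrix.toBilin' V)
    (fun x => by simpa [Matrix.toBilin'_apply'] using quad_nonneg hV x) u v
  simp only [Matrix.toBilin'_apply'] at h
  rwa [dotProduct_mulVec_symm hV.isHermitian v u, ← sq] at h

theorem det_isUnit (hV : V.PosDef) : IsUnit V.det := hV.det_pos.ne'.isUnit

theorem mulVec_inv_mulVec (hV : V.PosDef) (u : Fin d → ℝ) : V *ᵥ (V⁻¹ *ᵥ u) = u := by
  rw [Matrix.mulVec_mulVec, Matrix.mul_nonsing_inv _ (det_isUnit hV), Matrix.one_mulVec]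

theorem inv_mulVec_mulVec (hV : V.PosDef) (u : Fin d → ℝ) : V⁻¹ *ᵥ (V *ᵥ u) = u := by
  rw [Matrix.mulVec_mulVec, Matrix.nonsing_inv_mul _ (det_isUnit hV), Matrix.one_mulVec]

/-- Cauchy-Schwarz inequality for the dual pair of norms of `V` and `V⁻¹`. -/
theorem dotProduct_sq_le (hV : V.PosDef) (u v : Fin d → ℝ) :
    (u ⬝ᵥ v) ^ 2 ≤ (u ⬝ᵥ V *ᵥ u) * (v ⬝ᵥ V⁻¹ *ᵥ v) := by
  have h := dotProduct_mulVec_sq_le hV.posSemidef u (V⁻¹ *ᵥ v)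
  rw [mulVec_inv_mulVec hV] at h
  rwa [dotProduct_comm (V⁻¹ *ᵥ v) v] at h

theorem wnorm_nonneg (A : Matrix (Fin d) (Fin d) ℝ) (v : Vec d) : 0 ≤ wnorm A v :=
  Real.sqrt_nonneg _

theorem wnorm_sq (hV : V.PosSemidef) (v : Vec d) : wnorm V v ^ 2 = v.ofLp ⬝ᵥ V *ᵥ v.ofLp :=
  Real.sq_sqrt (quad_nonneg hV _)

theorem inner_eq_dotProduct (u v : Vec d) : inner ℝ u v = u.ofLp ⬝ᵥ v.ofLp := by
  simp [PiLp.inner_apply, dotProduct, mul_comm]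

theorem norm_sq_eq_dotProduct (u : Vec d) : ‖u‖ ^ 2 = u.ofLp ⬝ᵥ u.ofLp := by
  rw [← inner_eq_dotProduct, real_inner_self_eq_norm_sq]

theorem abs_inner_le_wnorm_mul_wnorm (hV : V.PosDef) (u v : Vec d) :
    |inner ℝ u v| ≤ wnorm V u * wnorm V⁻¹ v := by
  refine abs_le_of_sq_le_sq ?_ (mul_nonneg (wnorm_nonneg _ _) (wnorm_nonneg _ _))
  rw [mul_pow, wnorm_sq hV.posSemidef, wnorm_sq hV.inv.posSemidef, inner_eq_dotProduct]
  exact dotProduct_sq_le hV _ _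

theorem wnorm_add_le (hV : V.PosSemidef) (u v : Vec d) :
    wnorm V (u + v) ≤ wnorm V u + wnorm V v := by
  refine abs_le_of_sq_le_sq' ?_ (add_nonneg (wnorm_nonneg _ _) (wnorm_nonneg _ _)) |>.2
  have h : u.ofLp ⬝ᵥ V *ᵥ v.ofLp ≤ wnorm V u * wnorm V v := by
    refine (abs_le_of_sq_le_sq' ?_ (mul_nonneg (wnorm_nonneg _ _) (wnorm_nonneg _ _))).2
    rw [mul_pow, wnorm_sq hV, wnorm_sq hV]
    exact dotProduct_mulVec_sq_le hV _ _
  rw [wnorm_sq hV, add_sq, wnorm_sq hV, wnorm_sq hV, WithLp.ofLp_add, quad_add hV.isHermitian]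
  linarith

theorem wnorm_neg (A : Matrix (Fin d) (Fin d) ℝ) (v : Vec d) : wnorm A (-v) = wnorm A v := by
  simp [wnorm, Matrix.mulVec_neg]

theorem wnorm_sub_rev (A : Matrix (Fin d) (Fin d) ℝ) (u v : Vec d) :
    wnorm A (u - v) = wnorm A (v - u) := by
  rw [← wnorm_neg, neg_sub]

/-- For `u = V⁻¹x`, the bound `V ≥ 1` gives `‖u‖² ≤ ⟨x,u⟩`, and then `‖x - u‖² ≥ 0` gives `⟨x,u⟩ ≤
‖x‖²`. -/
theorem wnorm_inv_le_norm (hV : V.PosDef) (h1 : (V - 1).PosSemidef) (x : Vec d) :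
    wnorm V⁻¹ x ≤ ‖x‖ := by
  set u := V⁻¹ *ᵥ x.ofLp with hu
  have hx : V *ᵥ u = x.ofLp := mulVec_inv_mulVec hV _
  have h2 : u ⬝ᵥ u ≤ x.ofLp ⬝ᵥ u := by
    have := quad_nonneg h1 u
    rw [Matrix.sub_mulVec, Matrix.one_mulVec, dotProduct_sub, hx, dotProduct_comm u x.ofLp] at this
    linarith
  have h3 := norm_sq_eq_dotProduct x
  have h4 : x.ofLp ⬝ᵥ u ≤ ‖x‖ ^ 2 := by
    have h5 : 0 ≤ (x.ofLp - u) ⬝ᵥ (x.ofLp - u) := by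
      simpa using dotProduct_star_self_nonneg (x.ofLp - u)
    rw [sub_dotProduct, dotProduct_sub, dotProduct_sub, dotProduct_comm u x.ofLp] at h5
    linarith
  exact (Real.sqrt_le_sqrt h4).trans_eq (Real.sqrt_sq (norm_nonneg _))

theorem dotProduct_rankOne_mulVec (x v : Fin d → ℝ) :
    v ⬝ᵥ Matrix.vecMulVec x x *ᵥ v = (x ⬝ᵥ v) ^ 2 := by
  rw [Matrix.vecMulVec_mulVec]
  rw [op_smul_eq_smul, dotProduct_smul, smul_eq_mul, dotProduct_comm v x, sq]

theorem posSemidef_rankOne (x : Fin d → ℝ) : (Matrix.vecMulVec x x).PosSemidef := by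
  simpa using Matrix.posSemidef_vecMulVec_self_star x

theorem det_add_rankOne (hV : V.PosDef) (x : Fin d → ℝ) :
    (V + Matrix.vecMulVec x x).det = V.det * (1 + x ⬝ᵥ V⁻¹ *ᵥ x) := by
  rw [Matrix.vecMulVec_eq Unit, Matrix.det_add_replicateCol_mul_replicateRow (det_isUnit hV),
    Matrix.det_unique (n := Unit), Matrix.add_apply, Matrix.one_apply_eq, Matrix.mul_assoc, ← Matrix.replicateCol_mulVec, Matrix.replicateRow_mul_replicateCol_apply]

/-- Effect of a rank-one update on the inverse quadratic form. -/
theorem quad_inv_add_rankOne (hV : V.PosDef) (x S : Fin d → ℝ) (e : ℝ) :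
    (S + e • x) ⬝ᵥ (V + Matrix.vecMulVec x x)⁻¹ *ᵥ (S + e • x) =
      S ⬝ᵥ V⁻¹ *ᵥ S + (2 * (x ⬝ᵥ V⁻¹ *ᵥ S) * e + (x ⬝ᵥ V⁻¹ *ᵥ x) * e ^ 2
        - (x ⬝ᵥ V⁻¹ *ᵥ S) ^ 2) / (1 + x ⬝ᵥ V⁻¹ *ᵥ x) := by
  have hV' : (V + Matrix.vecMulVec x x).PosDef := hV.add_posSemidef (posSemidef_rankOne x)
  have hw : 0 ≤ x ⬝ᵥ V⁻¹ *ᵥ x := quad_nonneg hV.inv.posSemidef x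
  have hs : S ⬝ᵥ V⁻¹ *ᵥ x = x ⬝ᵥ V⁻¹ *ᵥ S := dotProduct_mulVec_symm hV.inv.isHermitian _ _
  set a := x ⬝ᵥ V⁻¹ *ᵥ S
  set w := x ⬝ᵥ V⁻¹ *ᵥ x
  -- Sherman–Morrison by ansatz: with the correction `t • V⁻¹x`, the updated system requires `t(1 +
  -- w) + a = e`.
  have hsol : (V + Matrix.vecMulVec x x)⁻¹ *ᵥ (S + e • x)
      = V⁻¹ *ᵥ S + ((e - a) / (1 + w)) • V⁻¹ *ᵥ x := by
    have h : (V + Matrix.vecMulVec x x) *ᵥ (V⁻¹ *ᵥ S + ((e - a) / (1 + w)) • V⁻¹ *ᵥ x)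
        = S + e • x := by
      rw [Matrix.add_mulVec, Matrix.vecMulVec_mulVec, Matrix.mulVec_add, Matrix.mulVec_smul,
        mulVec_inv_mulVec hV, mulVec_inv_mulVec hV, op_smul_eq_smul, dotProduct_add,
        dotProduct_smul, add_assoc, ← add_smul, smul_eq_mul]
      congr 2
      change (e - a) / (1 + w) + (a + (e - a) / (1 + w) * w) = e
      field_simp
      ring
    rw [← h, inv_mulVec_mulVec hV']
  rw [hsol, add_dotProduct, dotProduct_add, dotProduct_add, dotProduct_smul, smul_dotProduct,
    smul_dotProduct, dotProduct_smul, hs]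
  simp only [smul_eq_mul]
  change _ + (e - a) / (1 + w) * a + (e * a + e * ((e - a) / (1 + w) * w)) = _
  field_simp
  ring

end LinearAlgebra

/-! ### Covariance and noise sum of a data list. -/

section Data

variable {d : ℕ}

/-- Sum of the noise-weighted actions under the parameter `θ`. -/
def noiseSum (θ : Vec d) (D : Data d) : Fin d → ℝ :=
  (D.map fun p => (p.2 - inner ℝ p.1 θ) • p.1.ofLp).sum

theorem cov_nil : cov ([] : Data d) = 1 := by simp [cov]

theorem cov_append (D : Data d) (p : Vec d × ℝ) :
    cov (D ++ [p]) = cov D + Matrix.vecMulVec p.1.ofLp p.1.ofLp := by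
  simp [cov, add_assoc]

theorem noiseSum_append (θ : Vec d) (D : Data d) (p : Vec d × ℝ) :
    noiseSum θ (D ++ [p]) = noiseSum θ D + (p.2 - inner ℝ p.1 θ) • p.1.ofLp := by
  simp [noiseSum]

theorem cov_sub_one_posSemidef (D : Data d) : (cov D - 1).PosSemidef := by
  rw [cov, add_sub_cancel_left]
  induction D with
  | nil => simpa using Matrix.PosSemidef.zero
  | cons p D ih =>
    rw [List.map_cons, List.sum_cons]
    exact (posSemidef_rankOne _).add ih

theorem cov_posDef (D : Data d) : (cov D).PosDef := by
  have := Matrix.PosDef.one.add_posSemidef (cov_sub_one_posSemidef D)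
  rwa [add_sub_cancel] at this

theorem one_le_det_cov (D : Data d) : 1 ≤ (cov D).det := by
  induction D using List.reverseRecOn with
  | nil => simp [cov_nil]
  | append_singleton D p ih =>
    rw [cov_append, det_add_rankOne (cov_posDef D)]
    have := quad_nonneg (cov_posDef D).inv.posSemidef p.1.ofLp
    nlinarith

theorem quad_cov_le {L : ℝ} (D : Data d) (hD : ∀ p ∈ D, ‖p.1‖ ≤ L) (v : Vec d) :
    v.ofLp ⬝ᵥ cov D *ᵥ v.ofLp ≤ (1 + D.length * L ^ 2) * ‖v‖ ^ 2 := by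
  induction D using List.reverseRecOn with
  | nil => simp [cov_nil, norm_sq_eq_dotProduct]
  | append_singleton D p ih =>
    have h1 := ih fun q hq => hD q (by simp [hq])
    have h2 : ‖p.1‖ ≤ L := hD p (by simp)
    have h3 := abs_real_inner_le_norm p.1 v
    rw [cov_append, Matrix.add_mulVec, dotProduct_add, dotProduct_rankOne_mulVec]
    have h4 : (inner ℝ p.1 v : ℝ) ^ 2 ≤ L ^ 2 * ‖v‖ ^ 2 := by
      rw [← sq_abs, ← mul_pow]
      refine pow_le_pow_left₀ (abs_nonneg _) (h3.trans ?_) 2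
      gcongr
    rw [inner_eq_dotProduct] at h4
    simp only [List.length_append, List.length_singleton]
    push_cast
    linarith

/-- Each of the `d` eigenvalues is the quadratic form at a unit eigenvector. -/
theorem det_cov_le {L : ℝ} (D : Data d) (hD : ∀ p ∈ D, ‖p.1‖ ≤ L) :
    (cov D).det ≤ (1 + D.length * L ^ 2) ^ d := by
  have hH := (cov_posDef D).isHermitian
  rw [hH.det_eq_prod_eigenvalues]
  have h : ∀ i, hH.eigenvalues i ≤ 1 + D.length * L ^ 2 := fun i => by
    have h1 := quad_cov_le D hD (hH.eigenvectorBasis i)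
    rw [hH.eigenvectorBasis.orthonormal.1 i] at h1
    rw [hH.eigenvalues_eq]
    simpa using h1
  calc ∏ i, ((hH.eigenvalues i : ℝ) : ℝ) ≤ ∏ _i : Fin d, (1 + D.length * L ^ 2) :=
        Finset.prod_le_prod (fun i _ => (cov_posDef D).eigenvalues_pos i |>.le) fun i _ => h i
    _ = _ := by simp

end Data

/-! ### The Gaussian mixture and its one-step factor. -/

section Mixture

variable {d : ℕ}

/-- Likelihood ratio of one observation with noise `e` under a Gaussian mixture `N(a, w)` over the
noise mean. -/
def mixStep (a w e : ℝ) : ℝ :=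
  Real.exp ((2 * a * e + w * e ^ 2 - a ^ 2) / (2 * (1 + w))) / Real.sqrt (1 + w)

/-- The Gaussian mixture martingale `det(V)^{-1/2} exp (‖S‖²_{V⁻¹} / 2)`. -/
def mix (θ : Vec d) (D : Data d) : ℝ :=
  Real.exp (noiseSum θ D ⬝ᵥ (cov D)⁻¹ *ᵥ noiseSum θ D / 2) / Real.sqrt (cov D).det

theorem mixStep_nonneg (a w e : ℝ) : 0 ≤ mixStep a w e := by unfold mixStep; positivity

theorem mixStep_zero (e : ℝ) : mixStep 0 0 e = 1 := by simp [mixStep]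

theorem mix_nonneg (θ : Vec d) (D : Data d) : 0 ≤ mix θ D := by unfold mix; positivity

theorem mix_nil (θ : Vec d) : mix θ [] = 1 := by simp [mix, noiseSum, cov_nil]

/-- Under the prior `N(0, 1)` on a shift `λ` of the parameter, the posterior is `N(V⁻¹S, V⁻¹)`. The
two arguments of `mixStep` are the posterior mean and variance of `⟨λ, x⟩`. -/
theorem mix_append (θ : Vec d) (D : Data d) (x : Vec d) (e : ℝ) :
    mix θ (D ++ [(x, inner ℝ x θ + e)]) = mix θ D *
      mixStep (x.ofLp ⬝ᵥ (cov D)⁻¹ *ᵥ noiseSum θ D) (x.ofLp ⬝ᵥ (cov D)⁻¹ *ᵥ x.ofLp) e := by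
  have hV := cov_posDef D
  have hw : 0 ≤ x.ofLp ⬝ᵥ (cov D)⁻¹ *ᵥ x.ofLp := quad_nonneg hV.inv.posSemidef _
  simp only [mix, mixStep, cov_append, noiseSum_append, add_sub_cancel_left]
  rw [quad_inv_add_rankOne hV, det_add_rankOne hV, Real.sqrt_mul hV.det_pos.le, div_mul_div_comm,
    ← Real.exp_add]
  congr 2
  field_simp

/-- Complete the square in `l`: the product is `mixStep` times the density with mean `(a + we)/(1 +
w)` and variance `w/(1 + w)`. At `w = 0` the density is identically zero, so positivity is needed.
-/
theorem lintegral_gaussianPDFReal_mul_exp (a e : ℝ) {w : ℝ} (hw : 0 < w) :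
    ∫⁻ l, ENNReal.ofReal (ProbabilityTheory.gaussianPDFReal a w.toNNReal l *
      Real.exp (l * e - l ^ 2 / 2)) = ENNReal.ofReal (mixStep a w e) := by
  have h1w : 0 < 1 + w := by linarith
  have hv : (w / (1 + w)).toNNReal ≠ 0 := by
    rw [Ne, Real.toNNReal_eq_zero, not_le]; positivity
  have key : ∀ l, ProbabilityTheory.gaussianPDFReal a w.toNNReal l * Real.exp (l * e - l ^ 2 / 2)
      = mixStep a w e *
        ProbabilityTheory.gaussianPDFReal ((a + w * e) / (1 + w)) (w / (1 + w)).toNNReal l := by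
    intro l
    have h1 : Real.sqrt (2 * Real.pi * w)
        = Real.sqrt (1 + w) * Real.sqrt (2 * Real.pi * (w / (1 + w))) := by
      rw [← Real.sqrt_mul h1w.le]
      congr 1
      field_simp
    simp only [ProbabilityTheory.gaussianPDFReal, mixStep, Real.coe_toNNReal _ hw.le,
      Real.coe_toNNReal _ (div_pos hw h1w).le]
    have h2 : -(l - a) ^ 2 / (2 * w) + (l * e - l ^ 2 / 2) =
        (2 * a * e + w * e ^ 2 - a ^ 2) / (2 * (1 + w))
          + -(l - (a + w * e) / (1 + w)) ^ 2 / (2 * (w / (1 + w))) := by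
      field_simp
      ring
    rw [h1, mul_assoc, ← Real.exp_add, h2, Real.exp_add, mul_inv,
      div_eq_mul_inv _ (Real.sqrt (1 + w))]
    generalize Real.sqrt (1 + w) = s₁, Real.sqrt (2 * Real.pi * (w / (1 + w))) = s₂,
      Real.exp ((2 * a * e + w * e ^ 2 - a ^ 2) / (2 * (1 + w))) = e₁, Real.exp _ = e₂
    ring
  simp_rw [key, ENNReal.ofReal_mul (mixStep_nonneg a w e)]
  rw [lintegral_const_mul _ (by fun_prop), ProbabilityTheory.lintegral_gaussianPDFReal_eq_one _ hv,
    mul_one]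

end Mixture

/-! ### Conditional subgaussianity integrated against the mixture. -/

section Subgaussian

variable {Ω : Type*} {G m0 : MeasurableSpace Ω} {P : Measure Ω} [IsProbabilityMeasure P]

/-- Conditional subgaussianity, tested against nonnegative functions of the conditioning
information. -/
theorem lintegral_mul_exp_le (hG : G ≤ m0) {e : Ω → ℝ} (he : Measurable e) {r : ℝ}
    (hint : Integrable (fun ω => Real.exp (r * e ω)) P)
    (hsub : P[fun ω => Real.exp (r * e ω) | G] ≤ᵐ[P] fun _ => Real.exp (r ^ 2 / 2))
    {f : Ω → ℝ≥0∞} (hf : Measurable[G] f) :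
    ∫⁻ ω, f ω * ENNReal.ofReal (Real.exp (r * e ω)) ∂P ≤
      ∫⁻ ω, f ω * ENNReal.ofReal (Real.exp (r ^ 2 / 2)) ∂P := by
  have hg1 : Measurable fun ω => ENNReal.ofReal (Real.exp (r * e ω)) := by fun_prop
  -- As an inequality of measures on `G`, the bound passes at once from sets to all `G`-measurable
  -- `f ≥ 0`, integrable or not.
  have hle : (P.withDensity fun ω => ENNReal.ofReal (Real.exp (r * e ω))).trim hG ≤
      (P.withDensity fun _ => ENNReal.ofReal (Real.exp (r ^ 2 / 2))).trim hG := by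
    refine Measure.le_iff.2 fun s hs => ?_
    rw [trim_measurableSet_eq hG hs, trim_measurableSet_eq hG hs, withDensity_apply _ (hG s hs),
      withDensity_apply _ (hG s hs),
      ← ofReal_integral_eq_lintegral_ofReal hint.integrableOn
        (Filter.Eventually.of_forall fun _ => (Real.exp_pos _).le),
      ← ofReal_integral_eq_lintegral_ofReal (integrable_const _)
        (Filter.Eventually.of_forall fun _ => (Real.exp_pos _).le),
      ← setIntegral_condExp hG hint hs]
    exact ENNReal.ofReal_le_ofReal
      (setIntegral_mono_ae integrable_condExp.integrableOn (integrable_const _).integrableOn hsub)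
  have h := lintegral_mono' hle (le_refl f)
  rw [lintegral_trim hG hf, lintegral_trim hG hf,
    lintegral_withDensity_eq_lintegral_mul _ hg1 (hf.mono hG le_rfl),
    lintegral_withDensity_eq_lintegral_mul _ measurable_const (hf.mono hG le_rfl)] at h
  simpa only [Pi.mul_apply, mul_comm] using h

/-- Write `mixStep` as an integral over `l` and swap. For fixed `l` the noise bound at `r = l`
cancels `exp(-l²/2)`; after swapping back, the density integrates to one. Where `w = 0` the density
degenerates, but there `a = 0` and the factor is exactly 1. -/
theorem lintegral_mul_mixStep_le (hG : G ≤ m0) {e : Ω → ℝ} (he : Measurable e)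
    (hint : ∀ r : ℝ, Integrable (fun ω => Real.exp (r * e ω)) P)
    (hsub : ∀ r : ℝ, P[fun ω => Real.exp (r * e ω) | G] ≤ᵐ[P] fun _ => Real.exp (r ^ 2 / 2))
    {f : Ω → ℝ≥0∞} (hf : Measurable[G] f) {a w : Ω → ℝ} (ha : Measurable[G] a)
    (hw : Measurable[G] w) (hw0 : ∀ ω, 0 ≤ w ω) (hwa : ∀ ω, w ω = 0 → a ω = 0) :
    ∫⁻ ω, f ω * ENNReal.ofReal (mixStep (a ω) (w ω) (e ω)) ∂P ≤ ∫⁻ ω, f ω ∂P := by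
  have hS : MeasurableSet[G] {ω | w ω = 0} := hw (measurableSet_singleton 0)
  have hS' := hG _ hS
  rw [← lintegral_add_compl _ hS', ← lintegral_add_compl f hS']
  refine add_le_add (le_of_eq ?_) ?_
  · refine setLIntegral_congr_fun hS' fun ω hω => ?_
    have h0 : w ω = 0 := hω
    simp only [h0, hwa ω h0, mixStep_zero, ENNReal.ofReal_one, mul_one]
  have ha0 := ha.mono hG le_rfl
  have hw0' := hw.mono hG le_rfl
  set F : Ω → ℝ≥0∞ := {ω | w ω = 0}ᶜ.indicator f with hF
  have hFm : Measurable[G] F := hf.indicator hS.compl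
  have hFm0 := hFm.mono hG le_rfl
  set p : Ω → ℝ → ℝ := fun ω l => ProbabilityTheory.gaussianPDFReal (a ω) (w ω).toNNReal l with hp
  have hpm : Measurable fun q : Ω × ℝ => p q.1 q.2 :=
    ProbabilityTheory.measurable_uncurry_gaussianPDFReal.comp
      ((ha0.comp measurable_fst).prodMk
        ((hw0'.real_toNNReal.comp measurable_fst).prodMk measurable_snd))
  have hpl : ∀ l, Measurable[G] fun ω => p ω l := fun l =>
    ProbabilityTheory.measurable_uncurry_gaussianPDFReal.comp
      (ha.prodMk (hw.real_toNNReal.prodMk measurable_const))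
  have hp0 : ∀ ω l, 0 ≤ p ω l := fun ω l => ProbabilityTheory.gaussianPDFReal_nonneg _ _ _
  calc ∫⁻ ω in {ω | w ω = 0}ᶜ, f ω * ENNReal.ofReal (mixStep (a ω) (w ω) (e ω)) ∂P
      = ∫⁻ ω, (∫⁻ l, F ω * ENNReal.ofReal (p ω l * Real.exp (l * e ω - l ^ 2 / 2))) ∂P := by
        rw [← lintegral_indicator hS'.compl]
        refine lintegral_congr fun ω => ?_
        by_cases h : w ω = 0
        · simp [hF, h]
        · have hpos : 0 < w ω := lt_of_le_of_ne (hw0 ω) (Ne.symm h)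
          rw [lintegral_const_mul _ (by fun_prop), lintegral_gaussianPDFReal_mul_exp _ _ hpos]
          simp [hF, h]
    _ = ∫⁻ l, ∫⁻ ω, F ω * ENNReal.ofReal (p ω l * Real.exp (l * e ω - l ^ 2 / 2)) ∂P := by
        refine lintegral_lintegral_swap (Measurable.aemeasurable ?_)
        exact (hFm0.comp measurable_fst).mul (hpm.mul (by fun_prop)).ennreal_ofReal
    _ ≤ ∫⁻ l, ∫⁻ ω, F ω * ENNReal.ofReal (p ω l) ∂P := by
        refine lintegral_mono fun l => ?_
        have h := lintegral_mul_exp_le (P := P) hG he (hint l) (hsub l)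
          (f := fun ω => F ω * ENNReal.ofReal (p ω l * Real.exp (-(l ^ 2 / 2))))
          (hFm.mul ((hpl l).mul_const _).ennreal_ofReal)
        refine (le_of_eq ?_).trans (h.trans (le_of_eq ?_)) <;>
        · refine lintegral_congr fun ω => ?_
          have := mul_nonneg (hp0 ω l) (Real.exp_pos (-(l ^ 2 / 2))).le
          rw [mul_assoc, ← ENNReal.ofReal_mul this, mul_assoc, ← Real.exp_add]
          first
            | (rw [neg_add_cancel, Real.exp_zero, mul_one])
            | (congr 4; ring)
    _ = ∫⁻ ω, (∫⁻ l, F ω * ENNReal.ofReal (p ω l)) ∂P := by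
        refine (lintegral_lintegral_swap (Measurable.aemeasurable ?_)).symm
        exact (hFm0.comp measurable_fst).mul hpm.ennreal_ofReal
    _ = ∫⁻ ω in {ω | w ω = 0}ᶜ, f ω ∂P := by
        rw [← lintegral_indicator hS'.compl]
        refine lintegral_congr fun ω => ?_
        by_cases h : w ω = 0
        · simp [hF, h]
        · have hpos : (w ω).toNNReal ≠ 0 := by
            rw [Ne, Real.toNNReal_eq_zero, not_le]
            exact lt_of_le_of_ne (hw0 ω) (Ne.symm h)
          rw [lintegral_const_mul _ (by fun_prop),
            ProbabilityTheory.lintegral_gaussianPDFReal_eq_one _ hpos, mul_one]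

end Subgaussian

/-! ### Measurability through the sufficient statistics. -/

section Measurability

variable {d : ℕ}

instance matrixMeasurableSpace : MeasurableSpace (Matrix (Fin d) (Fin d) ℝ) := MeasurableSpace.pi

instance matrixBorelSpace : BorelSpace (Matrix (Fin d) (Fin d) ℝ) :=
  inferInstanceAs (BorelSpace (Fin d → Fin d → ℝ))

instance matrixSecondCountable :
    SecondCountableTopology (Matrix (Fin d) (Fin d) ℝ) :=
  inferInstanceAs (SecondCountableTopology (Fin d → Fin d → ℝ))

theorem measurable_det : Measurable fun V : Matrix (Fin d) (Fin d) ℝ => V.det :=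
  (continuous_id.matrix_det).measurable

theorem measurable_matrix_inv : Measurable fun V : Matrix (Fin d) (Fin d) ℝ => V⁻¹ := by
  refine measurable_pi_lambda _ fun i => measurable_pi_lambda _ fun j => ?_
  have h : ∀ V : Matrix (Fin d) (Fin d) ℝ, V⁻¹ i j = V.det⁻¹ * V.adjugate i j := fun V => by
    rw [Matrix.inv_def, Ring.inverse_eq_inv', Matrix.smul_apply, smul_eq_mul]
  simp_rw [h]
  exact measurable_det.inv.mul ((continuous_id.matrix_adjugate.matrix_elem i j).measurable)

theorem measurable_mulVec :
    Measurable fun p : Matrix (Fin d) (Fin d) ℝ × (Fin d → ℝ) => p.1 *ᵥ p.2 :=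
  (continuous_fst.matrix_mulVec continuous_snd).measurable

theorem measurable_dotProduct :
    Measurable fun p : (Fin d → ℝ) × (Fin d → ℝ) => p.1 ⬝ᵥ p.2 :=
  (continuous_fst.dotProduct continuous_snd).measurable

/-- Makes the estimate a function of two measurable statistics and exhibits its error: noise `V⁻¹S`
and regularization bias `-V⁻¹θ`. -/
theorem thetaHat_ofLp (θ : Vec d) (D : Data d) :
    (thetaHat D).ofLp = θ.ofLp + (cov D)⁻¹ *ᵥ (noiseSum θ D - θ.ofLp) := by
  have h : (D.map fun p => p.2 • p.1.ofLp).sum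
      = cov D *ᵥ θ.ofLp + (noiseSum θ D - θ.ofLp) := by
    induction D using List.reverseRecOn with
    | nil => simp [cov_nil, noiseSum]
    | append_singleton D p ih =>
      rw [cov_append, noiseSum_append, List.map_append, List.sum_append, ih, Matrix.add_mulVec,
        Matrix.vecMulVec_mulVec, op_smul_eq_smul, inner_eq_dotProduct, sub_smul]
      simp only [List.map_cons, List.map_nil, List.sum_cons, List.sum_nil, add_zero]
      abel
  rw [thetaHat, h, Matrix.mulVec_add, inv_mulVec_mulVec (cov_posDef D)]

variable {Ω : Type*} {m : MeasurableSpace Ω}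

/-- The sufficient statistics of the data are measurable functions on `Ω`. -/
structure StatMeasurable (m : MeasurableSpace Ω) (θ : Vec d) (D : Ω → Data d) : Prop where
  cov : Measurable[m] fun ω => cov (D ω)
  noiseSum : Measurable[m] fun ω => noiseSum θ (D ω)
  length : Measurable[m] fun ω => (D ω).length

namespace StatMeasurable

variable {θ : Vec d} {D : Ω → Data d}

theorem mono {m' : MeasurableSpace Ω} (h : StatMeasurable m θ D) (hm : m ≤ m') :
    StatMeasurable m' θ D :=
  ⟨h.cov.mono hm le_rfl, h.noiseSum.mono hm le_rfl, h.length.mono hm le_rfl⟩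

theorem covInv (h : StatMeasurable m θ D) : Measurable fun ω => (LinBandit.cov (D ω))⁻¹ :=
  measurable_matrix_inv.comp h.cov

theorem det (h : StatMeasurable m θ D) : Measurable fun ω => (LinBandit.cov (D ω)).det :=
  measurable_det.comp h.cov

theorem thetaHat (h : StatMeasurable m θ D) : Measurable fun ω => thetaHat (D ω) := by
  have h1 : Measurable fun ω => (LinBandit.thetaHat (D ω)).ofLp := by
    simp_rw [thetaHat_ofLp θ]
    exact measurable_const.add
      (measurable_mulVec.comp (h.covInv.prodMk (h.noiseSum.sub measurable_const)))
  exact (WithLp.measurable_toLp 2 _).comp h1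

theorem wnorm {V : Ω → Matrix (Fin d) (Fin d) ℝ} {v : Ω → Vec d} (hV : Measurable V)
    (hv : Measurable v) : Measurable fun ω => wnorm (V ω) (v ω) := by
  have h1 : Measurable fun ω => (v ω).ofLp := (WithLp.measurable_ofLp 2 _).comp hv
  exact (measurable_dotProduct.comp (h1.prodMk (measurable_mulVec.comp (hV.prodMk h1)))).sqrt

theorem beta (h : StatMeasurable m θ D) {c : Ω → ℝ} (hc : Measurable c) :
    Measurable fun ω => beta (D ω) (c ω) := by
  have hd := h.det
  unfold LinBandit.beta
  exact (((((hc.max measurable_const).log).const_mul 2).add hd.log).sqrt.add_const 1).pow_const 2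

theorem radius (h : StatMeasurable m θ D) : Measurable fun ω => radius (D ω) := by
  unfold LinBandit.radius localTime
  refine (h.beta (Measurable.pow_const ?_ 2)).sqrt
  exact (measurable_from_top (f := fun n : ℕ => ((n + 1 : ℕ) : ℝ))).comp h.length

theorem mix (h : StatMeasurable m θ D) : Measurable fun ω => mix θ (D ω) := by
  unfold LinBandit.mix
  have := measurable_dotProduct.comp
    (h.noiseSum.prodMk (measurable_mulVec.comp (h.covInv.prodMk h.noiseSum)))
  exact (this.div_const 2).exp.div h.det.sqrt

theorem const (D : Data d) : StatMeasurable m θ fun _ => D :=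
  ⟨measurable_const, measurable_const, measurable_const⟩

open Classical in
-- One round of the interaction: the data are kept or extended by one pair, and each statistic
-- changes by a measurable formula.
theorem ite (h : StatMeasurable m θ D) {s : Ω → Prop} (hs : MeasurableSet {ω | s ω})
    {p : Ω → Vec d × ℝ} (hp : Measurable p) :
    StatMeasurable m θ fun ω => if s ω then D ω else D ω ++ [p ω] := by
  have hx : Measurable fun ω => (p ω).1.ofLp :=
    (WithLp.measurable_ofLp 2 _).comp (measurable_fst.comp hp)
  refine ⟨?_, ?_, ?_⟩
  · have h1 : Measurable fun ω =>
        LinBandit.cov (D ω) + Matrix.vecMulVec (p ω).1.ofLp (p ω).1.ofLp := by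
      refine measurable_pi_lambda _ fun i => measurable_pi_lambda _ fun j => ?_
      exact (measurable_pi_iff.1 (measurable_pi_iff.1 h.cov i) j).add
        ((measurable_pi_iff.1 hx i).mul (measurable_pi_iff.1 hx j))
    have h2 := @Measurable.ite _ _ _ _ _ _ s
      (fun _ => Classical.propDecidable _) hs h.cov h1
    convert h2 using 2 with ω
    split_ifs
    · rfl
    · rw [cov_append]
  · have h1 : Measurable fun ω =>
        LinBandit.noiseSum θ (D ω) + ((p ω).2 - inner ℝ (p ω).1 θ) • (p ω).1.ofLp :=
      h.noiseSum.add (((measurable_snd.comp hp).sub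
        ((measurable_fst.comp hp).inner measurable_const)).smul hx)
    have h2 := @Measurable.ite _ _ _ _ _ _ s
      (fun _ => Classical.propDecidable _) hs h.noiseSum h1
    convert h2 using 2 with ω
    split_ifs
    · rfl
    · rw [noiseSum_append]
  · have h2 := @Measurable.ite _ _ _ _ _ _ s
      (fun _ => Classical.propDecidable _) hs h.length (h.length.add_const 1)
    convert h2 using 2 with ω
    split_ifs
    · rfl
    · simp

end StatMeasurable

theorem continuous_wnorm (V : Matrix (Fin d) (Fin d) ℝ) : Continuous (wnorm V) := by
  unfold wnorm
  refine Continuous.sqrt (Continuous.dotProduct (PiLp.continuous_ofLp 2 _) ?_)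
  exact Continuous.matrix_mulVec continuous_const (PiLp.continuous_ofLp 2 _)

/-! ### Closest alternatives and the exploitation event. -/

section Alternatives

variable {X : Finset (Vec d)} {M : Set (Vec d)}

theorem isCompact_altSet (hM : IsCompact M) (x z : Vec d) : IsCompact (altSet M x z) := by
  exact hM.inter_right (isClosed_le (f := fun _ => (0 : ℝ)) (g := fun ν => inner ℝ (z - x) ν)
    continuous_const (by fun_prop))

/-- Compactness attains the minimum, so `epsilon` in `nuHat` returns a true minimizer and not a
default value. -/
theorem nuHat_spec (hM : IsCompact M) (D : Data d) {x z : Vec d} (hne : (altSet M x z).Nonempty) :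
    nuHat M D x z ∈ altSet M x z ∧ ∀ ν ∈ altSet M x z,
      wnorm (cov D) (nuHat M D x z - thetaHat D) ≤ wnorm (cov D) (ν - thetaHat D) := by
  obtain ⟨ν, hν, hmin⟩ := (isCompact_altSet hM x z).exists_isMinOn hne
    (f := fun ν => wnorm (cov D) (ν - thetaHat D))
    ((continuous_wnorm _).comp (continuous_id.sub continuous_const)).continuousOn
  exact Classical.epsilon_spec (p := fun ν => ν ∈ altSet M x z ∧
    ∀ ν' ∈ altSet M x z, wnorm (cov D) (ν - thetaHat D) ≤ wnorm (cov D) (ν' - thetaHat D))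
    ⟨ν, hν, fun ν' hν' => hmin hν'⟩

theorem altCost_le (hM : IsCompact M) (D : Data d) {x z ν : Vec d} (hν : ν ∈ altSet M x z) :
    altCost M D x z ≤ wnorm (cov D) (ν - thetaHat D) ^ 2 / 2 := by
  unfold altCost
  have := (nuHat_spec hM D ⟨ν, hν⟩).2 ν hν
  have h0 := wnorm_nonneg (cov D) (nuHat M D x z - thetaHat D)
  gcongr

/-- The selection `nuHat` need not be measurable, but the minimal cost is an infimum over a
countable dense set of alternatives, by continuity. -/
theorem measurable_altCost (hM : IsCompact M) {θ : Vec d} {D : Ω → Data d}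
    (h : StatMeasurable m θ D) {x z : Vec d} (hne : (altSet M x z).Nonempty) :
    Measurable fun ω => ENNReal.ofReal (altCost M (D ω) x z) := by
  obtain ⟨T, hTs, hTc, hTd⟩ :=
    (TopologicalSpace.IsSeparable.of_separableSpace
      (altSet M x z)).exists_countable_dense_subset
  have key : ∀ ω, ENNReal.ofReal (altCost M (D ω) x z) =
      ⨅ ν ∈ T, ENNReal.ofReal (wnorm (cov (D ω)) (ν - thetaHat (D ω)) ^ 2 / 2) := fun ω => by
    refine le_antisymm (le_iInf₂ fun ν hν =>
      ENNReal.ofReal_le_ofReal (altCost_le hM _ (hTs hν))) ?_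
    have hcl : IsClosed {ν : Vec d |
        ⨅ ν ∈ T, ENNReal.ofReal (wnorm (cov (D ω)) (ν - thetaHat (D ω)) ^ 2 / 2) ≤
          ENNReal.ofReal (wnorm (cov (D ω)) (ν - thetaHat (D ω)) ^ 2 / 2)} := by
      refine isClosed_le continuous_const (ENNReal.continuous_ofReal.comp ?_)
      exact (((continuous_wnorm _).comp (continuous_id.sub continuous_const)).pow 2).div_const 2
    have hsub := hcl.closure_subset_iff.2 fun ν hν => iInf₂_le (f := fun ν (_ : ν ∈ T) =>
      ENNReal.ofReal (wnorm (cov (D ω)) (ν - thetaHat (D ω)) ^ 2 / 2)) ν hν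
    exact hsub (hTd (nuHat_spec hM (D ω) hne).1)
  simp_rw [key]
  refine Measurable.biInf T hTc fun ν _ => ?_
  exact (((StatMeasurable.wnorm h.cov (measurable_const.sub h.thetaHat)).pow_const 2).div_const
    2).ennreal_ofReal

theorem measurable_minCost (hM : IsCompact M) {θ : Vec d} {D : Ω → Data d}
    (h : StatMeasurable m θ D) (x : Vec d) : Measurable fun ω => minCost X M (D ω) x := by
  unfold minCost
  refine Measurable.biInf _ (Finset.countable_toSet _) fun z hz => ?_
  classical
  exact measurable_altCost hM h (Finset.mem_filter.1 hz).2.2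

variable {κ : ℝ}

/-- Split over the finitely many values of the empirically best action, since `minCost` is known to
be measurable only for a fixed action. -/
theorem measurableSet_exploits (hM : IsCompact M) (π : IDS X M κ) (t : ℕ) {θ : Vec d}
    {D : Ω → Data d} (h : StatMeasurable m θ D)
    (hx : Measurable fun ω => (π.xHat (D ω) : Vec d)) :
    MeasurableSet {ω | π.Exploits t (D ω)} := by
  have heq : {ω | π.Exploits t (D ω)} = ⋃ x : X, {ω | (π.xHat (D ω) : Vec d) = x} ∩
      {ω | ENNReal.ofReal (beta (D ω) (t * Real.log t) / 2) ≤ minCost X M (D ω) x} := by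
    ext ω
    simp only [IDS.Exploits, Set.mem_iUnion, Set.mem_inter_iff, Set.mem_ofPred_eq]
    constructor
    · exact fun h => ⟨_, rfl, h⟩
    · rintro ⟨x, hx, h⟩
      rwa [hx]
  rw [heq]
  refine MeasurableSet.iUnion fun x => (hx (measurableSet_singleton _)).inter ?_
  exact measurableSet_le ((h.beta measurable_const).div_const 2).ennreal_ofReal
    (measurable_minCost hM h x)

end Alternatives

end Measurability

/-! ### The data process and the stopped mixture. -/

section Run

variable {d : ℕ} {X : Finset (Vec d)} {M : Set (Vec d)} {κ : ℝ} {Ω : Type*}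

/-- Exploration data after the first `t` rounds of the interaction. -/
def runData (π : IDS X M κ) (θ : Vec d) (A : ℕ → Ω → Vec d) (ε : ℕ → Ω → ℝ) (t : ℕ) (ω : Ω) :
    Data d :=
  π.data (fun i => outcome θ A ε i ω) t

variable {π : IDS X M κ} {θ : Vec d} {A : ℕ → Ω → Vec d} {ε : ℕ → Ω → ℝ}

open Classical in
theorem runData_succ (t : ℕ) (ω : Ω) : runData π θ A ε (t + 1) ω =
    if π.Exploits (t + 1) (runData π θ A ε t ω) then runData π θ A ε t ω
    else runData π θ A ε t ω ++ [outcome θ A ε t ω] := rfl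

theorem length_runData_le (t : ℕ) (ω : Ω) : (runData π θ A ε t ω).length ≤ t := by
  induction t with
  | zero => simp [runData, IDS.data]
  | succ t ih =>
    rw [runData_succ]
    split_ifs
    · omega
    · simpa using ih

open Classical in
-- Truncation to `j` entries is stopping after `j` exploration rounds: the list is frozen in
-- exploitation rounds and once `j` entries are present.
theorem take_runData_succ (t j : ℕ) (ω : Ω) : (runData π θ A ε (t + 1) ω).take j =
    if π.Exploits (t + 1) (runData π θ A ε t ω) ∨ j ≤ (runData π θ A ε t ω).length
    then (runData π θ A ε t ω).take j
    else (runData π θ A ε t ω).take j ++ [outcome θ A ε t ω] := by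
  rw [runData_succ]
  by_cases h1 : π.Exploits (t + 1) (runData π θ A ε t ω)
  · simp [h1]
  · by_cases h2 : j ≤ (runData π θ A ε t ω).length
    · rw [if_neg h1, if_pos (Or.inr h2), List.take_append_of_le_length h2]
    · rw [if_neg h1, if_neg (by tauto), List.take_of_length_le, List.take_of_length_le]
      · omega
      · simp only [List.length_append, List.length_singleton]
        omega

/-- The `σ`-algebra generated by the first `t` rounds and the next action. -/
abbrev histAction (θ : Vec d) (A : ℕ → Ω → Vec d) (ε : ℕ → Ω → ℝ) (t : ℕ) : MeasurableSpace Ω :=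
  hist θ A ε t ⊔ MeasurableSpace.comap (A t) inferInstance

theorem hist_mono {s t : ℕ} (h : s ≤ t) : hist θ A ε s ≤ hist θ A ε t :=
  biSup_mono fun _ hi => Finset.mem_range.2 ((Finset.mem_range.1 hi).trans_le h)

theorem measurable_outcome {i t : ℕ} (h : i < t) : Measurable[hist θ A ε t] (outcome θ A ε i) :=
  Measurable.mono (comap_measurable _)
    (le_iSup₂_of_le i (Finset.mem_range.2 h) le_rfl) le_rfl

variable [m0 : MeasurableSpace Ω] {P : Measure Ω}

namespace IsRun

theorem hist_le (hr : IsRun π θ P A ε) (t : ℕ) : hist θ A ε t ≤ m0 := by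
  refine iSup₂_le fun i _ => Measurable.comap_le ?_
  exact (hr.measurable_action i).prodMk
    (((hr.measurable_action i).inner measurable_const).add (hr.measurable_noise i))

/-- All `j` are treated at once, because the freezing event at time `t` involves the full data,
which is the truncation at `j = t`. -/
theorem statMeasurable_take (hr : IsRun π θ P A ε) (hM : IsCompact M) (t : ℕ) :
    ∀ j, StatMeasurable (hist θ A ε t) θ fun ω => (runData π θ A ε t ω).take j := by
  induction t with
  | zero =>
    intro j
    simpa [runData, IDS.data] using StatMeasurable.const (m := hist θ A ε 0) (θ := θ) []
  | succ t ih =>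
    intro j
    have hD : StatMeasurable (hist θ A ε t) θ (runData π θ A ε t) := by
      convert ih t using 2 with ω
      rw [List.take_of_length_le (length_runData_le t ω)]
    have h1 := measurableSet_exploits hM π (t + 1) hD (hr.measurable_xHat t)
    have h2 : MeasurableSet[hist θ A ε t] {ω | j ≤ (runData π θ A ε t ω).length} :=
      measurableSet_le measurable_const hD.length
    have hle := hist_mono (θ := θ) (A := A) (ε := ε) t.le_succ
    convert ((ih j).mono hle).ite (hle _ (h1.union h2)) (measurable_outcome t.lt_succ_self)
      using 2 with ω
    classical
    rw [take_runData_succ]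
    by_cases h : π.Exploits (t + 1) (runData π θ A ε t ω) ∨ j ≤ (runData π θ A ε t ω).length
    · rw [if_pos h]
      exact (if_pos h).symm
    · rw [if_neg h]
      exact (if_neg h).symm

theorem statMeasurable (hr : IsRun π θ P A ε) (hM : IsCompact M) (t : ℕ) :
    StatMeasurable (hist θ A ε t) θ (runData π θ A ε t) := by
  convert hr.statMeasurable_take hM t t using 2 with ω
  rw [List.take_of_length_le (length_runData_le t ω)]

theorem measurableSet_exploits (hr : IsRun π θ P A ε) (hM : IsCompact M) (t : ℕ) :
    MeasurableSet[hist θ A ε t] {ω | π.Exploits (t + 1) (runData π θ A ε t ω)} :=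
  LinBandit.measurableSet_exploits hM π (t + 1) (hr.statMeasurable hM t) (hr.measurable_xHat t)

/-- The mixture martingale stopped after `j` exploration rounds has expectation at most `1`. -/
theorem lintegral_mix_take_le_one [IsProbabilityMeasure P] (hr : IsRun π θ P A ε)
    (hM : IsCompact M) (j t : ℕ) :
    ∫⁻ ω, ENNReal.ofReal (mix θ ((runData π θ A ε t ω).take j)) ∂P ≤ 1 := by
  classical
  induction t with
  | zero => simp [runData, IDS.data, mix_nil]
  | succ t ih =>
    refine le_trans ?_ ih
    have hG : histAction θ A ε t ≤ m0 := sup_le (hr.hist_le t) (hr.measurable_action t).comap_le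
    have hHG : hist θ A ε t ≤ histAction θ A ε t := le_sup_left
    have hA : Measurable[histAction θ A ε t] (A t) := (comap_measurable (A t)).mono le_sup_right le_rfl
    have hA' : Measurable[histAction θ A ε t] fun ω => (A t ω).ofLp := (WithLp.measurable_ofLp 2 _).comp hA
    set D : Ω → Data d := fun ω => (runData π θ A ε t ω).take j with hDdef
    have hD : StatMeasurable (histAction θ A ε t) θ D := (hr.statMeasurable_take hM t j).mono hHG
    set U : Set Ω := {ω | π.Exploits (t + 1) (runData π θ A ε t ω) ∨
      j ≤ (runData π θ A ε t ω).length} with hU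
    have hUm : MeasurableSet[histAction θ A ε t] U := hHG _ ((hr.measurableSet_exploits hM t).union
      (measurableSet_le measurable_const (hr.statMeasurable hM t).length))
    -- Setting `a = w = 0` on the freezing event turns the factor into `mixStep 0 0 = 1`, so frozen
    -- and active outcomes obey one inequality.
    set a : Ω → ℝ := Uᶜ.indicator fun ω =>
      (A t ω).ofLp ⬝ᵥ (cov (D ω))⁻¹ *ᵥ noiseSum θ (D ω) with ha
    set w : Ω → ℝ := Uᶜ.indicator fun ω =>
      (A t ω).ofLp ⬝ᵥ (cov (D ω))⁻¹ *ᵥ (A t ω).ofLp with hw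
    have ham : Measurable[histAction θ A ε t] a := Measurable.indicator (measurable_dotProduct.comp
      (hA'.prodMk (measurable_mulVec.comp (hD.covInv.prodMk hD.noiseSum)))) hUm.compl
    have hwm : Measurable[histAction θ A ε t] w := Measurable.indicator (measurable_dotProduct.comp
      (hA'.prodMk (measurable_mulVec.comp (hD.covInv.prodMk hA')))) hUm.compl
    have hw0 : ∀ ω, 0 ≤ w ω := fun ω =>
      Set.indicator_nonneg (fun ω _ => quad_nonneg (cov_posDef _).inv.posSemidef _) ω
    -- Cauchy–Schwarz: `a² ≤ w ‖S‖²_{V⁻¹}`.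
    have hwa : ∀ ω, w ω = 0 → a ω = 0 := fun ω h => by
      by_cases hω : ω ∈ U
      · simp [ha, hω]
      · have hω' : ω ∈ Uᶜ := hω
        rw [hw, Set.indicator_of_mem hω'] at h
        rw [ha, Set.indicator_of_mem hω']
        have := dotProduct_mulVec_sq_le (cov_posDef (D ω)).inv.posSemidef (A t ω).ofLp
          (noiseSum θ (D ω))
        rw [h, zero_mul] at this
        exact pow_eq_zero_iff two_ne_zero |>.1 (le_antisymm this (sq_nonneg _))
    have hstep := lintegral_mul_mixStep_le (P := P) hG (hr.measurable_noise t)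
      (hr.noise_integrable t) (hr.noise_subgaussian t)
      (f := fun ω => ENNReal.ofReal (mix θ (D ω))) hD.mix.ennreal_ofReal ham hwm hw0 hwa
    refine (le_of_eq ?_).trans hstep
    refine lintegral_congr fun ω => ?_
    rw [take_runData_succ, ← ENNReal.ofReal_mul (mix_nonneg _ _)]
    congr 1
    by_cases hω : ω ∈ U
    · have hω' : ω ∉ Uᶜ := fun h => h hω
      rw [if_pos (show _ ∨ _ from hω), ha, hw, Set.indicator_of_notMem hω', Set.indicator_of_notMem hω', mixStep_zero,
        mul_one]
    · have hω' : ω ∈ Uᶜ := hω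
      rw [if_neg (show ¬(_ ∨ _) from hω), ha, hw, Set.indicator_of_mem hω', Set.indicator_of_mem hω', ← mix_append]
      rfl

/-- Markov's inequality for the stopped mixture martingale. -/
theorem measureReal_mix_take_ge_le [IsProbabilityMeasure P] (hr : IsRun π θ P A ε)
    (hM : IsCompact M) (j t : ℕ) {c : ℝ} (hc : 0 < c) :
    P.real {ω | c ≤ mix θ ((runData π θ A ε t ω).take j)} ≤ 1 / c := by
  have hm : Measurable fun ω => ENNReal.ofReal (mix θ ((runData π θ A ε t ω).take j)) :=
    (((hr.statMeasurable_take hM t j).mono (hr.hist_le t)).mix).ennreal_ofReal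
  have h := mul_meas_ge_le_lintegral (μ := P) hm (ENNReal.ofReal c)
  have hset : {ω | ENNReal.ofReal c ≤ ENNReal.ofReal (mix θ ((runData π θ A ε t ω).take j))}
      = {ω | c ≤ mix θ ((runData π θ A ε t ω).take j)} := by
    ext ω
    exact ENNReal.ofReal_le_ofReal_iff (mix_nonneg _ _)
  rw [hset] at h
  have h2 := h.trans (hr.lintegral_mix_take_le_one hM j t)
  have h3 := ENNReal.toReal_mono ENNReal.one_ne_top h2
  rw [ENNReal.toReal_mul, ENNReal.toReal_ofReal hc.le, ENNReal.toReal_one] at h3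
  rw [le_div_iff₀ hc, mul_comm]
  exact h3

end IsRun

end Run

/-! ### Consequences of a correct confidence set. -/

section Confidence

variable {d : ℕ} {X : Finset (Vec d)} {M : Set (Vec d)} {κ : ℝ}

theorem beta_nonneg (D : Data d) (c : ℝ) : 0 ≤ beta D c := sq_nonneg _

theorem sqrt_beta (D : Data d) (c : ℝ) : Real.sqrt (beta D c) =
    Real.sqrt (2 * Real.log (max c 1) + Real.log (cov D).det) + 1 :=
  Real.sqrt_sq (by positivity)

/-- The error in the `V`-norm equals `‖S - θ‖_{V⁻¹}`. Taking logarithms in the hypothesis bounds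
`‖S‖_{V⁻¹}` by the square root in `beta`; its `+ 1` pays for `‖θ‖_{V⁻¹} ≤ ‖θ‖ ≤ 1`. -/
theorem wnorm_sub_thetaHat_lt {θ : Vec d} (hθ : ‖θ‖ ≤ 1) {D : Data d} {c : ℝ}
    (h : mix θ D < max c 1) : wnorm (cov D) (θ - thetaHat D) < Real.sqrt (beta D c) := by
  have hV := cov_posDef D
  have hdet := hV.det_pos
  have hc : 0 < max c 1 := lt_max_of_lt_right one_pos
  have heq : wnorm (cov D) (θ - thetaHat D)
      = wnorm (cov D)⁻¹ (WithLp.toLp 2 (noiseSum θ D) + -θ) := by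
    rw [wnorm_sub_rev]
    have hu : (thetaHat D - θ).ofLp = (cov D)⁻¹ *ᵥ (noiseSum θ D - θ.ofLp) := by
      rw [WithLp.ofLp_sub, thetaHat_ofLp θ, add_sub_cancel_left]
    have hv : (WithLp.toLp 2 (noiseSum θ D) + -θ).ofLp = noiseSum θ D - θ.ofLp := by
      simp [sub_eq_add_neg]
    rw [wnorm, wnorm, hu, hv, mulVec_inv_mulVec hV, dotProduct_comm]
  have h1 : wnorm (cov D)⁻¹ (WithLp.toLp 2 (noiseSum θ D)) <
      Real.sqrt (2 * Real.log (max c 1) + Real.log (cov D).det) := by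
    refine Real.sqrt_lt_sqrt (quad_nonneg hV.inv.posSemidef _) ?_
    rw [mix, div_lt_iff₀ (Real.sqrt_pos.2 hdet)] at h
    have h2 := Real.log_lt_log (Real.exp_pos _) h
    rw [Real.log_exp, Real.log_mul hc.ne' (Real.sqrt_pos.2 hdet).ne', Real.log_sqrt hdet.le] at h2
    linarith
  rw [sqrt_beta, heq]
  have h3 := wnorm_add_le hV.inv.posSemidef (WithLp.toLp 2 (noiseSum θ D)) (-θ)
  rw [wnorm_neg] at h3
  have h4 := wnorm_inv_le_norm hV (cov_sub_one_posSemidef D) θ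
  linarith

/-- In exploitation rounds with a correct confidence set the played action is optimal. -/
theorem inner_le_of_exploits (hM : IsCompact M) {π : IDS X M κ} {θ : Vec d} (hθ : ‖θ‖ ≤ 1)
    (hθM : θ ∈ M) {t : ℕ} {D : Data d} (hex : π.Exploits t D)
    (h : mix θ D < max (t * Real.log t) 1) {x : Vec d} (hx : x ∈ X) :
    (inner ℝ x θ : ℝ) ≤ inner ℝ (π.xHat D : Vec d) θ := by
  classical
  by_contra! hlt
  -- The true parameter is itself an alternative, so its distance bounds the minimal cost from
  -- above.
  have hmem : θ ∈ altSet M (π.xHat D : Vec d) x := by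
    refine ⟨hθM, ?_⟩
    rw [inner_sub_left]
    linarith
  have hne : x ≠ (π.xHat D : Vec d) := fun h => by rw [h] at hlt; exact lt_irrefl _ hlt
  have halt : x ∈ alts X M (π.xHat D : Vec d) := Finset.mem_filter.2 ⟨hx, hne, θ, hmem⟩
  have h1 : minCost X M D (π.xHat D) ≤ ENNReal.ofReal (altCost M D (π.xHat D) x) :=
    iInf₂_le (f := fun z (_ : z ∈ alts X M (π.xHat D : Vec d)) =>
      ENNReal.ofReal (altCost M D (π.xHat D) z)) x halt
  have h2 := altCost_le hM D hmem
  have h3 := wnorm_sub_thetaHat_lt hθ h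
  have h4 : wnorm (cov D) (θ - thetaHat D) ^ 2 < beta D (t * Real.log t) := by
    have := pow_lt_pow_left₀ h3 (wnorm_nonneg _ _) two_ne_zero
    rwa [Real.sq_sqrt (beta_nonneg _ _)] at this
  have h5 : beta D (t * Real.log t) / 2 ≤ altCost M D (π.xHat D) x := by
    refine (ENNReal.ofReal_le_ofReal_iff ?_).1 (le_trans hex h1)
    unfold altCost
    positivity
  linarith

/-- Optimism: the maximal index dominates the true reward of `z`. The gap estimate uses the plain
estimated reward of `x`, whose error costs one more bonus. -/
theorem inner_sub_inner_le_gapEst {θ : Vec d} (hθ : ‖θ‖ ≤ 1) {D : Data d}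
    (h : mix θ D < max ((localTime D : ℝ) ^ 2) 1) {x z : Vec d} (hz : z ∈ X) :
    inner ℝ z θ - inner ℝ x θ ≤ gapEst X D x + radius D * wnorm (cov D)⁻¹ x := by
  have hV := cov_posDef D
  have h1 : wnorm (cov D) (θ - thetaHat D) ≤ radius D := (wnorm_sub_thetaHat_lt hθ h).le
  have h2 : ∀ y : Vec d,
      |(inner ℝ y θ : ℝ) - inner ℝ y (thetaHat D)| ≤ radius D * wnorm (cov D)⁻¹ y := fun y => by
    rw [← inner_sub_right, real_inner_comm]
    exact (abs_inner_le_wnorm_mul_wnorm hV _ _).trans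
      (mul_le_mul_of_nonneg_right h1 (wnorm_nonneg _ _))
  have h3 : inner ℝ z (thetaHat D) + radius D * wnorm (cov D)⁻¹ z ≤
      ⨆ z : X, (inner ℝ (z : Vec d) (thetaHat D) + radius D * wnorm (cov D)⁻¹ (z : Vec d)) :=
    le_ciSup (f := fun z : X =>
      (inner ℝ (z : Vec d) (thetaHat D) + radius D * wnorm (cov D)⁻¹ (z : Vec d)))
      (Set.finite_range _).bddAbove ⟨z, hz⟩
  have h4 := (abs_le.1 (h2 z)).2
  have h5 := (abs_le.1 (h2 x)).1
  unfold gapEst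
  linarith

end Confidence

/-! ### Two-sided control of the information gain. -/

section Information

variable {d : ℕ} {X : Finset (Vec d)} {M : Set (Vec d)} {κ : ℝ}

/-- A Gibbs distribution has mean cost at most the minimal cost plus `log k / η`. -/
theorem gibbs_mean_le {ι : Type*} {s : Finset ι} {c : ι → ℝ} {η : ℝ} (hη : 0 < η) {k : ℕ}
    (hk : s.card ≤ k) {z₀ : ι} (hz₀ : z₀ ∈ s) :
    ∑ z ∈ s, Real.exp (-η * c z) / (∑ z' ∈ s, Real.exp (-η * c z')) * c z
      ≤ c z₀ + Real.log k / η := by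
  set Z := ∑ z' ∈ s, Real.exp (-η * c z') with hZ
  have hle : Real.exp (-η * c z₀) ≤ Z :=
    Finset.single_le_sum (f := fun z => Real.exp (-η * c z)) (fun _ _ => (Real.exp_pos _).le) hz₀
  have hZpos : 0 < Z := (Real.exp_pos _).trans_le hle
  have hlogZ : -η * c z₀ ≤ Real.log Z := by
    rw [Real.le_log_iff_exp_le hZpos]; exact hle
  have hkpos : (0 : ℝ) < k := by
    have := Finset.card_pos.2 ⟨z₀, hz₀⟩
    exact_mod_cast this.trans_le hk
  have hsum : ∑ z ∈ s, Real.exp (-η * c z) / Z = 1 := by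
    rw [← Finset.sum_div, ← hZ, div_self hZpos.ne']
  -- The entropy bound `log k`, termwise: `log Z ≥ -η c z₀` and `log (1/(kq)) ≤ 1/(kq) - 1`. The
  -- remainders `(1/k - q)/η` have a nonpositive sum because `s.card ≤ k`.
  have hterm : ∀ z ∈ s, Real.exp (-η * c z) / Z * c z ≤
      Real.exp (-η * c z) / Z * (c z₀ + Real.log k / η) +
        (1 / k - Real.exp (-η * c z) / Z) / η := fun z _ => by
    set q := Real.exp (-η * c z) / Z with hq
    have hqpos : 0 < q := div_pos (Real.exp_pos _) hZpos
    have h1 : Real.log q = -η * c z - Real.log Z := by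
      rw [hq, Real.log_div (Real.exp_pos _).ne' hZpos.ne', Real.log_exp]
    have h2 := Real.log_le_sub_one_of_pos (x := 1 / (k * q)) (by positivity)
    rw [one_div, Real.log_inv, Real.log_mul hkpos.ne' hqpos.ne'] at h2
    have h3 : q * (η * c z - η * c z₀ - Real.log k) ≤ q * ((k * q)⁻¹ - 1) :=
      mul_le_mul_of_nonneg_left (by linarith) hqpos.le
    have h4 : q * ((k * q)⁻¹ - 1) = 1 / k - q := by field_simp
    rw [h4] at h3
    have h5 : q * c z - q * (c z₀ + Real.log k / η) ≤ (1 / k - q) / η := by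
      rw [le_div_iff₀ hη]
      have : (q * c z - q * (c z₀ + Real.log k / η)) * η
          = q * (η * c z - η * c z₀ - Real.log k) := by
        field_simp
        ring
      rw [this]
      exact h3
    linarith
  refine (Finset.sum_le_sum hterm).trans ?_
  rw [Finset.sum_add_distrib, ← Finset.sum_mul, hsum, one_mul, ← Finset.sum_div,
    Finset.sum_sub_distrib, hsum, Finset.sum_const, nsmul_eq_mul]
  have : (s.card : ℝ) * (1 / k) ≤ 1 := by
    rw [mul_one_div, div_le_one hkpos]
    exact_mod_cast hk
  have h6 : ((s.card : ℝ) * (1 / k) - 1) / η ≤ 0 := div_nonpos_of_nonpos_of_nonneg (by linarith) hη.le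
  linarith

theorem qWeight_nonneg (D : Data d) (x : Vec d) (η : ℝ) (z : Vec d) :
    0 ≤ qWeight X M D x η z :=
  div_nonneg (Real.exp_pos _).le (Finset.sum_nonneg fun _ _ => (Real.exp_pos _).le)

theorem sum_qWeight (D : Data d) {x : Vec d} (η : ℝ) (hne : (alts X M x).Nonempty) :
    ∑ z ∈ alts X M x, qWeight X M D x η z = 1 := by
  unfold qWeight
  rw [← Finset.sum_div]
  exact div_self (Finset.sum_pos (fun _ _ => Real.exp_pos _) hne).ne'

theorem altCost_nonneg (D : Data d) (x z : Vec d) : 0 ≤ altCost M D x z := by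
  unfold altCost; positivity

theorem radius_nonneg (D : Data d) : 0 ≤ radius D := Real.sqrt_nonneg _

/-- Only the bonus part of the square is kept; the weights sum to one. This makes the UCB action
informative enough to compete with IDS. -/
theorem infoGain_ge (D : Data d) {x : Vec d} (η : ℝ) (hne : (alts X M x).Nonempty) (y : Vec d) :
    (radius D * wnorm (cov D)⁻¹ y) ^ 2 / 2 ≤ infoGain X M D x η y := by
  have h : ∑ z ∈ alts X M x, qWeight X M D x η z * (radius D * wnorm (cov D)⁻¹ y) ^ 2 ≤
      ∑ z ∈ alts X M x, qWeight X M D x η z *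
        (|inner ℝ (nuHat M D x z - thetaHat D) y| + radius D * wnorm (cov D)⁻¹ y) ^ 2 := by
    refine Finset.sum_le_sum fun z _ => mul_le_mul_of_nonneg_left ?_ (qWeight_nonneg _ _ _ _)
    have h0 : 0 ≤ radius D * wnorm (cov D)⁻¹ y := mul_nonneg (radius_nonneg _) (wnorm_nonneg _ _)
    exact pow_le_pow_left₀ h0 (le_add_of_nonneg_left (abs_nonneg _)) 2
  rw [← Finset.sum_mul, sum_qWeight D η hne] at h
  unfold infoGain
  linarith

theorem infoGain_nonneg (D : Data d) (x : Vec d) (η : ℝ) (y : Vec d) :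
    0 ≤ infoGain X M D x η y :=
  mul_nonneg (by norm_num) (Finset.sum_nonneg fun _ _ =>
    mul_nonneg (qWeight_nonneg _ _ _ _) (sq_nonneg _))

/-- Use `(a + b)² ≤ 2a² + 2b²` and Cauchy–Schwarz; the squared distance to an alternative is twice
its cost. -/
theorem infoGain_le_sum (D : Data d) {x : Vec d} (η : ℝ) (hne : (alts X M x).Nonempty)
    (y : Vec d) : infoGain X M D x η y ≤
      (2 * ∑ z ∈ alts X M x, qWeight X M D x η z * altCost M D x z + radius D ^ 2) *
        wnorm (cov D)⁻¹ y ^ 2 := by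
  have h : ∀ z ∈ alts X M x, qWeight X M D x η z *
        (|inner ℝ (nuHat M D x z - thetaHat D) y| + radius D * wnorm (cov D)⁻¹ y) ^ 2 ≤
      qWeight X M D x η z * altCost M D x z * (4 * wnorm (cov D)⁻¹ y ^ 2) +
        qWeight X M D x η z * (2 * (radius D ^ 2 * wnorm (cov D)⁻¹ y ^ 2)) := fun z _ => by
    rw [mul_assoc, ← mul_add]
    refine mul_le_mul_of_nonneg_left ?_ (qWeight_nonneg _ _ _ _)
    have h1 := abs_inner_le_wnorm_mul_wnorm (cov_posDef D) (nuHat M D x z - thetaHat D) y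
    have h2 := pow_le_pow_left₀ (abs_nonneg _) h1 2
    unfold altCost
    nlinarith [sq_nonneg (|inner ℝ (nuHat M D x z - thetaHat D) y|
      - radius D * wnorm (cov D)⁻¹ y)]
  have h2 := Finset.sum_le_sum h
  rw [Finset.sum_add_distrib, ← Finset.sum_mul, ← Finset.sum_mul, sum_qWeight D η hne] at h2
  unfold infoGain
  linarith

theorem minCost_eq (D : Data d) {x : Vec d} (hne : (alts X M x).Nonempty) :
    ∃ z ∈ alts X M x, minCost X M D x = ENNReal.ofReal (altCost M D x z) := by
  obtain ⟨z, hz, hmin⟩ := Finset.exists_min_image (alts X M x) (altCost M D x) hne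
  exact ⟨z, hz, le_antisymm (iInf₂_le z hz)
    (le_iInf₂ fun z' hz' => ENNReal.ofReal_le_ofReal (hmin z' hz'))⟩

/-- Without alternatives the minimal cost is the empty infimum `∞`, and the test for exploitation
holds. -/
theorem alts_nonempty_of_not_exploits {π : IDS X M κ} {t : ℕ} {D : Data d}
    (h : ¬π.Exploits t D) : (alts X M (π.xHat D : Vec d)).Nonempty := by
  by_contra hne
  refine h ?_
  rw [Finset.not_nonempty_iff_eq_empty] at hne
  simp [IDS.Exploits, minCost, hne]

theorem minCost_le_of_not_exploits {π : IDS X M κ} {t : ℕ} {D : Data d} (h : ¬π.Exploits t D) :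
    (minCost X M D (π.xHat D)).toReal ≤ beta D (t * Real.log t) / 2 := by
  have h1 := ENNReal.toReal_mono ENNReal.ofReal_ne_top (not_le.1 h).le
  rwa [ENNReal.toReal_ofReal (div_nonneg (beta_nonneg _ _) zero_le_two)] at h1

theorem infoGain_le {π : IDS X M κ} {D : Data d} (hne : (alts X M (π.xHat D : Vec d)).Nonempty)
    {B : ℝ} (hB : ∀ l ≤ D.length, (minCost X M (D.take l) (π.xHat (D.take l))).toReal ≤ B)
    (y : Vec d) : infoGain X M D (π.xHat D) (π.eta D) y ≤
      (2 * (B + |κ| * (2 + B)) + beta D ((localTime D : ℝ) ^ 2)) * wnorm (cov D)⁻¹ y ^ 2 := by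
  classical
  refine (infoGain_le_sum D _ hne y).trans (mul_le_mul_of_nonneg_right ?_ (sq_nonneg _))
  have hr : radius D ^ 2 = beta D ((localTime D : ℝ) ^ 2) := Real.sq_sqrt (beta_nonneg _ _)
  rw [hr]
  obtain ⟨z, hz, hmin⟩ := minCost_eq D hne
  have hη := π.eta_pos D
  have h1 := gibbs_mean_le (c := altCost M D (π.xHat D)) hη
    (k := X.card) (Finset.card_le_card (Finset.filter_subset _ X) : (alts X M _).card ≤ _) hz
  have h2 : altCost M D (π.xHat D) z ≤ B := by
    have := hB D.length le_rfl
    rwa [List.take_length, hmin, ENNReal.toReal_ofReal (altCost_nonneg _ _ _)] at this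
  have hB0 : 0 ≤ B := (altCost_nonneg _ _ _).trans h2
  have h3 : Real.log X.card / π.eta D ≤ |κ| * (2 + B) := by
    obtain ⟨l, hl, h⟩ := π.eta_rate D
    -- The crude `√m ≤ 1 + m` is harmless, since `B` will have the same order as `beta`.
    have hs : Real.sqrt (minCost X M (D.take l) (π.xHat (D.take l))).toReal ≤ 1 + B := by
      rw [Real.sqrt_le_left (by linarith)]
      nlinarith [hB l hl]
    rw [div_le_iff₀ hη, mul_comm _ (π.eta D)]
    refine h.trans (mul_le_mul_of_nonneg_left ?_ hη.le)
    refine (mul_le_mul_of_nonneg_right (le_abs_self κ) (by positivity)).trans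
      (mul_le_mul_of_nonneg_left (by linarith) (abs_nonneg _))
  have h4 : ∑ z ∈ alts X M (π.xHat D : Vec d), qWeight X M D (π.xHat D) (π.eta D) z *
      altCost M D (π.xHat D) z ≤ B + |κ| * (2 + B) := by
    unfold qWeight
    linarith
  linarith

/-- The IDS distribution has information ratio at most that of the UCB action. -/
theorem sq_sum_gapEst_le {π : IDS X M κ} {D : Data d}
    (hne : (alts X M (π.xHat D : Vec d)).Nonempty) :
    (∑ y : X, π.mu D y * gapEst X D y) ^ 2 ≤
      2 * ∑ y : X, π.mu D y * infoGain X M D (π.xHat D) (π.eta D) y := by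
  classical
  have : Nonempty X := ⟨π.xHat D⟩
  obtain ⟨u, hu⟩ := exists_eq_ciSup_of_finite (f := fun z : X =>
    (inner ℝ (z : Vec d) (thetaHat D) + radius D * wnorm (cov D)⁻¹ (z : Vec d)))
  -- For the maximizer `u` of the UCB index the estimated rewards cancel, leaving the bonus.
  have hgap : gapEst X D u = radius D * wnorm (cov D)⁻¹ (u : Vec d) := by
    rw [gapEst, ← hu]
    ring
  have h1 := π.mu_min D (Pi.single u 1) (single_mem_stdSimplex ℝ u)
  have h2 : infoRatio X M D (π.xHat D) (π.eta D) (Pi.single u 1) ≤ 2 := by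
    have hs : ∀ f : X → ℝ, ∑ y : X, (Pi.single u 1 : X → ℝ) y * f y = f u := fun f => by
      simp [Pi.single_apply]
    rw [infoRatio, hs (fun y => gapEst X D y), hs (fun y => infoGain X M D _ _ y), hgap]
    refine ENNReal.div_le_of_le_mul ?_
    rw [← ENNReal.ofReal_ofNat, ← ENNReal.ofReal_mul zero_le_two]
    refine ENNReal.ofReal_le_ofReal ?_
    linarith [infoGain_ge D (π.eta D) hne (u : Vec d)]
  have h3 : 0 ≤ ∑ y : X, π.mu D y * infoGain X M D (π.xHat D) (π.eta D) y :=
    Finset.sum_nonneg fun y _ => mul_nonneg ((π.mu_mem D).1 y) (infoGain_nonneg _ _ _ _)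
  have h4 := h1.trans h2
  -- The bound 2 is neither `0` nor `∞`, so the product form also holds when the information gain
  -- vanishes.
  rw [infoRatio, ENNReal.div_le_iff_le_mul (Or.inr (by simp)) (Or.inr (by simp)),
    ← ENNReal.ofReal_ofNat, ← ENNReal.ofReal_mul zero_le_two,
    ENNReal.ofReal_le_ofReal_iff (by positivity)] at h4
  simpa using h4

end Information

/-! ### Orders of magnitude and the regret of one exploration round. -/

section Exploration

variable {d : ℕ} {X : Finset (Vec d)} {M : Set (Vec d)} {κ : ℝ}

theorem one_half_le_log {n : ℕ} (hn : 2 ≤ n) : 1 / 2 ≤ Real.log n := by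
  have h1 : Real.log 2 ≤ Real.log n := Real.log_le_log two_pos (by exact_mod_cast hn)
  linarith [Real.log_two_gt_d9]

theorem log_det_cov_le {L : ℝ} {n : ℕ} (hn : 2 ≤ n) {D : Data d} (hD : ∀ p ∈ D, ‖p.1‖ ≤ L)
    (hlen : D.length ≤ n) :
    Real.log (cov D).det ≤ (1 + 2 * L ^ 2) * (d * Real.log n) := by
  have hn0 : (1 : ℝ) ≤ n := by exact_mod_cast (by omega : 1 ≤ n)
  have hlog := one_half_le_log hn
  have hlen' : (D.length : ℝ) ≤ n := by exact_mod_cast hlen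
  have h1 := Real.log_le_log (cov_posDef D).det_pos (det_cov_le D hD)
  rw [Real.log_pow] at h1
  have h2 : Real.log (1 + D.length * L ^ 2) ≤ Real.log n + L ^ 2 := by
    have h3 : 1 + D.length * L ^ 2 ≤ n * (1 + L ^ 2) := by nlinarith [sq_nonneg L]
    have h4 := Real.log_le_log (by positivity) h3
    rw [Real.log_mul (by positivity) (by positivity)] at h4
    have h5 := Real.log_le_sub_one_of_pos (x := 1 + L ^ 2) (by positivity)
    linarith
  have h6 : Real.log (1 + D.length * L ^ 2) ≤ (1 + 2 * L ^ 2) * Real.log n := by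
    nlinarith [sq_nonneg L]
  calc Real.log (cov D).det ≤ d * Real.log (1 + D.length * L ^ 2) := h1
    _ ≤ d * ((1 + 2 * L ^ 2) * Real.log n) := by gcongr
    _ = _ := by ring

theorem beta_le {L : ℝ} {n : ℕ} (hn : 2 ≤ n) (hd : 1 ≤ d) {D : Data d}
    (hD : ∀ p ∈ D, ‖p.1‖ ≤ L) (hlen : D.length ≤ n) {c : ℝ} (hc : c ≤ (n : ℝ) ^ 2) :
    beta D c ≤ (14 + 4 * L ^ 2) * (d * Real.log n) := by
  have hn0 : (1 : ℝ) ≤ n := by exact_mod_cast (by omega : 1 ≤ n)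
  have hlog := one_half_le_log hn
  have hd' : (1 : ℝ) ≤ d := by exact_mod_cast hd
  have h1 : Real.log (max c 1) ≤ 2 * Real.log n := by
    have h2 : max c 1 ≤ (n : ℝ) ^ 2 := max_le hc (one_le_pow₀ hn0)
    have := Real.log_le_log (lt_max_of_lt_right one_pos) h2
    rwa [Real.log_pow] at this
  have h3 := log_det_cov_le hn hD hlen
  have h4 : 0 ≤ Real.log (max c 1) := Real.log_nonneg (le_max_right _ _)
  have h5 : 0 ≤ Real.log (cov D).det := Real.log_nonneg (one_le_det_cov D)
  have h6 := Real.sq_sqrt (show 0 ≤ 2 * Real.log (max c 1) + Real.log (cov D).det by positivity)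
  unfold beta
  set s := Real.sqrt (2 * Real.log (max c 1) + Real.log (cov D).det)
  have h7 : Real.log n ≤ d * Real.log n := le_mul_of_one_le_left (by linarith) hd'
  -- From `(s + 1)² ≤ 2s² + 2`: the level gives 8, the determinant `2 + 4L²`, and `2 ≤ 4 log n` the
  -- remaining 4.
  nlinarith [sq_nonneg (s - 1)]

/-- Expected regret of an exploration round with a correct confidence set, up to the potential. -/
theorem sum_mu_regret_le {π : IDS X M κ} {θ : Vec d} (hθ : ‖θ‖ ≤ 1) {D : Data d}
    (hne : (alts X M (π.xHat D : Vec d)).Nonempty)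
    (h : mix θ D < max ((localTime D : ℝ) ^ 2) 1) {x₀ : Vec d} (hx₀ : x₀ ∈ X) {K b c : ℝ}
    (hK : ∀ y, infoGain X M D (π.xHat D) (π.eta D) y ≤ K * wnorm (cov D)⁻¹ y ^ 2)
    (hb : beta D ((localTime D : ℝ) ^ 2) ≤ b) (hc : 0 < c) :
    ∑ x : X, π.mu D x *
      (inner ℝ (x₀ - x) θ - (2 * K + b) / c * wnorm (cov D)⁻¹ (x : Vec d) ^ 2) ≤ c / 2 := by
  have hmu := π.mu_mem D
  have hr : radius D ^ 2 = beta D ((localTime D : ℝ) ^ 2) := Real.sq_sqrt (beta_nonneg _ _)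
  have h1 := sq_sum_gapEst_le hne
  have h2 : ∑ y : X, π.mu D y * infoGain X M D (π.xHat D) (π.eta D) y ≤
      ∑ y : X, π.mu D y * (K * wnorm (cov D)⁻¹ (y : Vec d) ^ 2) :=
    Finset.sum_le_sum fun y _ => mul_le_mul_of_nonneg_left (hK y) (hmu.1 y)
  set g := ∑ y : X, π.mu D y * gapEst X D y with hg
  set W := ∑ y : X, π.mu D y * wnorm (cov D)⁻¹ (y : Vec d) ^ 2 with hW
  have h3 : ∑ y : X, π.mu D y * (K * wnorm (cov D)⁻¹ (y : Vec d) ^ 2) = K * W := by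
    rw [hW, Finset.mul_sum]
    exact Finset.sum_congr rfl fun _ _ => by ring
  have h4 : ∀ x : X, (inner ℝ (x₀ - x) θ : ℝ) ≤
      gapEst X D x + (b * wnorm (cov D)⁻¹ (x : Vec d) ^ 2 / c + c / 4) := fun x => by
    have h5 := inner_sub_inner_le_gapEst (x := x) hθ h hx₀
    rw [inner_sub_left]
    -- AM-GM as `v ≤ v²/c + c/4`, here for the bonus and below for `g` with `g² ≤ 2KW`; the two
    -- quarters make `c/2`.
    have h6 : radius D * wnorm (cov D)⁻¹ (x : Vec d) ≤
        b * wnorm (cov D)⁻¹ (x : Vec d) ^ 2 / c + c / 4 := by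
      rw [div_add' _ _ _ hc.ne', le_div_iff₀ hc]
      have h7 : radius D ^ 2 * wnorm (cov D)⁻¹ (x : Vec d) ^ 2
          ≤ b * wnorm (cov D)⁻¹ (x : Vec d) ^ 2 := by
        rw [hr]
        exact mul_le_mul_of_nonneg_right hb (sq_nonneg _)
      nlinarith [sq_nonneg (radius D * wnorm (cov D)⁻¹ (x : Vec d) - c / 2)]
    linarith
  calc ∑ x : X, π.mu D x *
        (inner ℝ (x₀ - x) θ - (2 * K + b) / c * wnorm (cov D)⁻¹ (x : Vec d) ^ 2)
      ≤ ∑ x : X, (π.mu D x * gapEst X D x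
          - π.mu D x * wnorm (cov D)⁻¹ (x : Vec d) ^ 2 * (2 * K / c) + π.mu D x * (c / 4)) := by
        refine Finset.sum_le_sum fun x _ => ?_
        have := mul_le_mul_of_nonneg_left (h4 x) (hmu.1 x)
        have h8 : (2 * K + b) / c = 2 * K / c + b / c := add_div _ _ _
        rw [h8]
        have h9 : b * wnorm (cov D)⁻¹ (x : Vec d) ^ 2 / c
            = b / c * wnorm (cov D)⁻¹ (x : Vec d) ^ 2 := by ring
        rw [h9] at this
        linarith
    _ = g - W * (2 * K / c) + c / 4 := by
        rw [Finset.sum_add_distrib, Finset.sum_sub_distrib, ← Finset.sum_mul, ← Finset.sum_mul,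
          hmu.2, one_mul]
    _ ≤ c / 2 := by
        have h10 : g ≤ W * (2 * K / c) + c / 4 := by
          have h11 : W * (2 * K / c) = 2 * (K * W) / c := by ring
          rw [h11, div_add' _ _ _ hc.ne', le_div_iff₀ hc]
          nlinarith [sq_nonneg (g - c / 2)]
        linarith

end Exploration

/-! ### Pathwise bounds along a trajectory. -/

section Path

variable {d : ℕ} {X : Finset (Vec d)} {M : Set (Vec d)} {κ : ℝ} {Ω : Type*}
  {π : IDS X M κ} {θ : Vec d} {A : ℕ → Ω → Vec d} {ε : ℕ → Ω → ℝ}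

theorem norm_le_of_mem_runData {L : ℝ} {ω : Ω} (hA : ∀ i, ‖A i ω‖ ≤ L) (t : ℕ) :
    ∀ p ∈ runData π θ A ε t ω, ‖p.1‖ ≤ L := by
  induction t with
  | zero => simp [runData, IDS.data]
  | succ t ih =>
    intro p hp
    rw [runData_succ] at hp
    split_ifs at hp
    · exact ih p hp
    · rcases List.mem_append.1 hp with hp | hp
      · exact ih p hp
      · rw [List.mem_singleton.1 hp]
        exact hA t

/-- A proper prefix was the full data in the round that collected its next entry, and that round was
an exploration. -/
theorem exists_round_of_lt_length (t : ℕ) (ω : Ω) :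
    ∀ l < (runData π θ A ε t ω).length, ∃ i < t,
      runData π θ A ε i ω = (runData π θ A ε t ω).take l ∧
        ¬π.Exploits (i + 1) (runData π θ A ε i ω) := by
  induction t with
  | zero => simp [runData, IDS.data]
  | succ t ih =>
    intro l hl
    rw [runData_succ] at hl ⊢
    split_ifs at hl ⊢ with hex
    · obtain ⟨i, hi, h⟩ := ih l hl
      exact ⟨i, hi.trans t.lt_succ_self, h⟩
    · rcases Nat.lt_or_ge l (runData π θ A ε t ω).length with hlt | hge
      · obtain ⟨i, hi, h⟩ := ih l hlt
        rw [List.take_append_of_le_length hlt.le]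
        exact ⟨i, hi.trans t.lt_succ_self, h⟩
      · have : l = (runData π θ A ε t ω).length := by
          simp only [List.length_append, List.length_singleton] at hl
          omega
        exact ⟨t, t.lt_succ_self, by rw [this, List.take_left' rfl], hex⟩

open Classical in
-- Change of time from rounds to local time: each exploration round lengthens the list by one.
theorem sum_explore_eq (g : Data d → ℝ) (t : ℕ) (ω : Ω) :
    ∑ i ∈ Finset.range t, (if π.Exploits (i + 1) (runData π θ A ε i ω) then 0
        else g (runData π θ A ε i ω)) =
      ∑ j ∈ Finset.range (runData π θ A ε t ω).length, g ((runData π θ A ε t ω).take j) := by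
  induction t with
  | zero => simp [runData, IDS.data]
  | succ t ih =>
    rw [Finset.sum_range_succ, ih, runData_succ]
    split_ifs
    · simp
    · rw [List.length_append, List.length_singleton, Finset.sum_range_succ, List.take_left' rfl]
      congr 1
      refine Finset.sum_congr rfl fun j hj => ?_
      rw [List.take_append_of_le_length (Finset.mem_range.1 hj).le]

open Classical in
/-- Elliptical potential bound. -/
theorem sum_potential_le {L : ℝ} {ω : Ω} (hA : ∀ i, ‖A i ω‖ ≤ L) (t : ℕ) :
    ∑ i ∈ Finset.range t, (if π.Exploits (i + 1) (runData π θ A ε i ω) then 0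
        else wnorm (cov (runData π θ A ε i ω))⁻¹ (A i ω) ^ 2) ≤
      (1 + L ^ 2) * Real.log (cov (runData π θ A ε t ω)).det := by
  induction t with
  | zero => simp [runData, IDS.data, cov_nil]
  | succ t ih =>
    rw [Finset.sum_range_succ, runData_succ]
    split_ifs
    · simpa using ih
    · have hV := cov_posDef (runData π θ A ε t ω)
      have hw := wnorm_sq hV.inv.posSemidef (A t ω)
      rw [cov_append, det_add_rankOne hV]
      simp only [outcome]
      rw [← hw, Real.log_mul hV.det_pos.ne' (by positivity), mul_add]
      refine add_le_add ih ?_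
      have h1 : wnorm (cov (runData π θ A ε t ω))⁻¹ (A t ω) ≤ L :=
        (wnorm_inv_le_norm hV (cov_sub_one_posSemidef _) _).trans (hA t)
      have h2 := pow_le_pow_left₀ (wnorm_nonneg _ _) h1 2
      set u := wnorm (cov (runData π θ A ε t ω))⁻¹ (A t ω) ^ 2
      have hu : 0 ≤ u := sq_nonneg _
      -- Yields `u/(1 + u) ≤ log(1 + u)`; with `u ≤ L²` this gives `u ≤ (1 + L²) log(1 + u)`.
      have h3 := Real.one_sub_inv_le_log_of_pos (show 0 < 1 + u by linarith)
      have h4 : 1 - (1 + u)⁻¹ = u / (1 + u) := by field_simp; ring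
      rw [h4, div_le_iff₀ (by linarith)] at h3
      have h5 : 0 ≤ Real.log (1 + u) := Real.log_nonneg (by linarith)
      nlinarith

/-- The learning-rate condition looks back at all earlier local times. Each of them saw an
exploration round, where the failed test bounds the minimal cost by `β/2`. -/
theorem minCost_take_le {L : ℝ} {n : ℕ} (hn : 2 ≤ n) (hd : 1 ≤ d) {ω : Ω}
    (hA : ∀ i, ‖A i ω‖ ≤ L) {t : ℕ} (ht : t < n)
    (hex : ¬π.Exploits (t + 1) (runData π θ A ε t ω)) :
    ∀ l ≤ (runData π θ A ε t ω).length,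
      (minCost X M ((runData π θ A ε t ω).take l)
        (π.xHat ((runData π θ A ε t ω).take l))).toReal ≤
      (14 + 4 * L ^ 2) * (d * Real.log n) := by
  have key : ∀ i < n, ¬π.Exploits (i + 1) (runData π θ A ε i ω) →
      (minCost X M (runData π θ A ε i ω) (π.xHat (runData π θ A ε i ω))).toReal ≤
        (14 + 4 * L ^ 2) * (d * Real.log n) := fun i hi hex => by
    have h1 := minCost_le_of_not_exploits hex
    have hi' : ((i + 1 : ℕ) : ℝ) ≤ n := by exact_mod_cast hi
    have hpos : (0 : ℝ) < ((i + 1 : ℕ) : ℝ) := by positivity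
    have hc : ((i + 1 : ℕ) : ℝ) * Real.log (i + 1 : ℕ) ≤ (n : ℝ) ^ 2 := by
      rw [sq]
      have h2 := Real.log_le_sub_one_of_pos hpos
      have h3 : 0 ≤ Real.log (i + 1 : ℕ) := Real.log_natCast_nonneg _
      exact mul_le_mul hi' (by linarith) h3 (by positivity)
    have h4 := beta_le hn hd (norm_le_of_mem_runData (π := π) (θ := θ) (ε := ε) hA i)
      ((length_runData_le i ω).trans hi.le) hc
    have := beta_nonneg (runData π θ A ε i ω) (((i + 1 : ℕ) : ℝ) * Real.log (i + 1 : ℕ))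
    linarith
  intro l hl
  rcases hl.lt_or_eq with hlt | rfl
  · obtain ⟨i, hi, heq, hex'⟩ := exists_round_of_lt_length t ω l hlt
    rw [← heq]
    exact key i (hi.trans ht) hex'
  · rw [List.take_length]
    exact key t ht hex

end Path

/-! ### Expectations over the randomized action. -/

section ActionLaw

variable {d : ℕ} {X : Finset (Vec d)} {M : Set (Vec d)} {κ : ℝ} {Ω : Type*}
  {π : IDS X M κ} {θ : Vec d} {A : ℕ → Ω → Vec d} {ε : ℕ → Ω → ℝ}
  [m0 : MeasurableSpace Ω] {P : Measure Ω}

theorem actionLaw_mem (π : IDS X M κ) (t : ℕ) (D : Data d) :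
    π.actionLaw t D ∈ stdSimplex ℝ X := by
  classical
  unfold IDS.actionLaw
  split_ifs
  · convert single_mem_stdSimplex ℝ (π.xHat D)
  · exact π.mu_mem D

namespace IsRun

/-- The law `mu` carries no measurability assumption; integrability comes from its agreement almost
everywhere with a conditional expectation. -/
theorem integrable_actionLaw_mul (hr : IsRun π θ P A ε) (t : ℕ) (x : X) {g : Ω → ℝ}
    (hg : Measurable[hist θ A ε t] g) {b : ℝ} (hb : ∀ ω, |g ω| ≤ b) :
    Integrable (fun ω => π.actionLaw (t + 1) (runData π θ A ε t ω) x * g ω) P := by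
  have h1 : Integrable (fun ω => π.actionLaw (t + 1) (runData π θ A ε t ω) x) P :=
    integrable_condExp.congr (hr.action_law t x)
  exact h1.mul_bdd (c := b) (hg.mono (hr.hist_le t) le_rfl).aestronglyMeasurable
    (Filter.Eventually.of_forall hb)

variable [IsProbabilityMeasure P]

theorem integral_indicator_action_mul (hr : IsRun π θ P A ε) (t : ℕ) (x : X) {g : Ω → ℝ}
    (hg : Measurable[hist θ A ε t] g) {b : ℝ} (hb : ∀ ω, |g ω| ≤ b) :
    Integrable (fun ω => (A t ⁻¹' {(x : Vec d)}).indicator (fun _ => (1 : ℝ)) ω * g ω) P ∧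
    ∫ ω, (A t ⁻¹' {(x : Vec d)}).indicator (fun _ => (1 : ℝ)) ω * g ω ∂P =
      ∫ ω, π.actionLaw (t + 1) (runData π θ A ε t ω) x * g ω ∂P := by
  have hle := hr.hist_le t
  have h1 : Integrable ((A t ⁻¹' {(x : Vec d)}).indicator (fun _ => (1 : ℝ))) P :=
    (integrable_const 1).indicator (hr.measurable_action t (measurableSet_singleton _))
  have h2 : Integrable ((A t ⁻¹' {(x : Vec d)}).indicator (fun _ => (1 : ℝ)) * g) P :=
    h1.mul_bdd (c := b) (hg.mono hle le_rfl).aestronglyMeasurable (Filter.Eventually.of_forall hb)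
  refine ⟨h2, ?_⟩
  have h3 := condExp_mul_of_stronglyMeasurable_right hg.stronglyMeasurable h2 h1
  calc _ = ∫ ω, (P[(A t ⁻¹' {(x : Vec d)}).indicator (fun _ => (1 : ℝ)) * g | hist θ A ε t]) ω ∂P :=
        (integral_condExp hle).symm
    _ = _ := by
        refine integral_congr_ae ?_
        filter_upwards [h3, hr.action_law t x] with ω hω1 hω2
        rw [hω1, Pi.mul_apply, hω2]
        rfl

theorem sum_indicator_action {x : Vec d} (f : X → ℝ) :
    (∑ y : X, (if x = y then 1 else 0) * f y) = if h : x ∈ X then f ⟨x, h⟩ else 0 := by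
  classical
  split_ifs with h
  · rw [Finset.sum_eq_single ⟨x, h⟩]
    · simp
    · intro y _ hy
      rw [if_neg fun hxy => hy (Subtype.ext hxy.symm), zero_mul]
    · simp
  · refine Finset.sum_eq_zero fun y _ => ?_
    rw [if_neg fun hxy : x = (y : Vec d) => h (hxy ▸ y.2), zero_mul]

/-- The action is constrained only through its conditional law; as that law has total mass one on
`X`, the probabilities of `A t = x` sum to one. -/
theorem ae_action_mem (hr : IsRun π θ P A ε) (t : ℕ) : ∀ᵐ ω ∂P, A t ω ∈ X := by
  classical
  have hms : MeasurableSet {ω | A t ω ∈ X} :=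
    hr.measurable_action t X.finite_toSet.measurableSet
  have h0 : ∀ x : X, ∫ ω, (A t ⁻¹' {(x : Vec d)}).indicator (fun _ => (1 : ℝ)) ω * 1 ∂P =
      ∫ ω, π.actionLaw (t + 1) (runData π θ A ε t ω) x * 1 ∂P := fun x =>
    (hr.integral_indicator_action_mul t x (g := fun _ => 1) measurable_const (b := 1)
      (fun _ => by simp)).2
  have h1 : ∫ ω, ∑ x : X, (A t ⁻¹' {(x : Vec d)}).indicator (fun _ => (1 : ℝ)) ω * 1 ∂P = 1 := by
    rw [integral_finsetSum _ fun x _ => (hr.integral_indicator_action_mul t x (g := fun _ => 1)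
      measurable_const (b := 1) (fun _ => by simp)).1, Finset.sum_congr rfl fun x _ => h0 x,
      ← integral_finsetSum _ fun x _ => hr.integrable_actionLaw_mul t x (g := fun _ => 1)
      measurable_const (b := 1) (fun _ => by simp)]
    have : ∀ ω, ∑ x : X, π.actionLaw (t + 1) (runData π θ A ε t ω) x * 1 = 1 := fun ω => by
      simpa using (actionLaw_mem π (t + 1) (runData π θ A ε t ω)).2
    simp_rw [this]
    simp
  have h2 : (fun ω => ∑ x : X, (A t ⁻¹' {(x : Vec d)}).indicator (fun _ => (1 : ℝ)) ω * 1)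
      = {ω | A t ω ∈ X}.indicator fun _ => (1 : ℝ) := by
    ext ω
    simp only [Set.indicator_apply, Set.mem_preimage, Set.mem_singleton_iff]
    rw [sum_indicator_action (fun _ : X => 1)]
    simp
  rw [h2, integral_indicator_const _ hms, smul_eq_mul, mul_one] at h1
  exact (prob_compl_eq_zero_iff hms).2 ((ENNReal.toReal_eq_one_iff _).1 h1)

/-- Expectations of functions of the next action and the past are computed with the action law. -/
theorem integral_action_le (hr : IsRun π θ P A ε) (t : ℕ) {f : Vec d → Ω → ℝ}
    (hf : ∀ x ∈ X, Measurable[hist θ A ε t] (f x)) {b c : ℝ}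
    (hb : ∀ x ∈ X, ∀ ω, |f x ω| ≤ b)
    (hc : ∀ᵐ ω ∂P, ∑ x : X, π.actionLaw (t + 1) (runData π θ A ε t ω) x * f x ω ≤ c) :
    Integrable (fun ω => f (A t ω) ω) P ∧ ∫ ω, f (A t ω) ω ∂P ≤ c := by
  classical
  have h0 := fun x : X => hr.integral_indicator_action_mul t x (hf x x.2) (hb x x.2)
  have h1 : (fun ω => ∑ x : X, (A t ⁻¹' {(x : Vec d)}).indicator (fun _ => (1 : ℝ)) ω * f x ω)
      =ᵐ[P] fun ω => f (A t ω) ω := by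
    filter_upwards [hr.ae_action_mem t] with ω hω
    simp only [Set.indicator_apply, Set.mem_preimage, Set.mem_singleton_iff]
    rw [sum_indicator_action (fun x : X => f x ω), dif_pos hω]
  have h2 : Integrable (fun ω => ∑ x : X,
      (A t ⁻¹' {(x : Vec d)}).indicator (fun _ => (1 : ℝ)) ω * f x ω) P :=
    integrable_finsetSum _ fun x _ => (h0 x).1
  refine ⟨h2.congr h1, ?_⟩
  have h3 := fun x : X => hr.integrable_actionLaw_mul t x (hf x x.2) (hb x x.2)
  rw [← integral_congr_ae h1, integral_finsetSum _ fun x _ => (h0 x).1,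
    Finset.sum_congr rfl fun x _ => (h0 x).2, ← integral_finsetSum _ fun x _ => h3 x]
  refine (integral_mono_ae (integrable_finsetSum _ fun x _ => h3 x) (integrable_const c) hc).trans ?_
  simp

end IsRun

end ActionLaw

/-! ### Assembling the regret bound. -/

section Regret

variable {d : ℕ} {X : Finset (Vec d)} {M : Set (Vec d)} {κ : ℝ} {Ω : Type*}
  {π : IDS X M κ} {θ : Vec d} {A : ℕ → Ω → Vec d} {ε : ℕ → Ω → ℝ}

theorem pathRegret_eq {x₀ : Vec d} (hx₀ : x₀ ∈ X) (hmax : ∀ x ∈ X, (inner ℝ x θ : ℝ) ≤ inner ℝ x₀ θ)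
    (n : ℕ) (ω : Ω) :
    pathRegret X θ A n ω = ∑ t ∈ Finset.range n, (inner ℝ (x₀ - A t ω) θ : ℝ) := by
  have : Nonempty X := ⟨⟨x₀, hx₀⟩⟩
  refine le_antisymm (ciSup_le fun x => Finset.sum_le_sum fun t _ => ?_)
    (le_ciSup (f := fun x : X => ∑ t ∈ Finset.range n, (inner ℝ ((x : Vec d) - A t ω) θ : ℝ))
      (Set.finite_range _).bddAbove ⟨x₀, hx₀⟩)
  rw [inner_sub_left, inner_sub_left]
  linarith [hmax x x.2]

theorem abs_inner_sub_le_one (hX : Metric.diam (X : Set (Vec d)) ≤ 1) (hθ : ‖θ‖ ≤ 1) {x y : Vec d}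
    (hx : x ∈ X) (hy : y ∈ X) : |(inner ℝ (x - y) θ : ℝ)| ≤ 1 := by
  refine (abs_real_inner_le_norm _ _).trans ?_
  have h1 : ‖x - y‖ ≤ 1 := by
    rw [← dist_eq_norm]
    exact (Metric.dist_le_diam_of_mem X.finite_toSet.isBounded hx hy).trans hX
  exact mul_le_one₀ h1 (norm_nonneg _) hθ

/-- The set of outcomes with exploitation in round `t + 1` and a correct confidence set. -/
def goodExploit (π : IDS X M κ) (θ : Vec d) (A : ℕ → Ω → Vec d) (ε : ℕ → Ω → ℝ) (t : ℕ) : Set Ω :=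
  {ω | π.Exploits (t + 1) (runData π θ A ε t ω)} ∩
    {ω | mix θ (runData π θ A ε t ω) < max (((t + 1 : ℕ) : ℝ) * Real.log (t + 1 : ℕ)) 1}

/-- The set of outcomes with exploration in round `t + 1` and a correct confidence set. -/
def goodExplore (π : IDS X M κ) (θ : Vec d) (A : ℕ → Ω → Vec d) (ε : ℕ → Ω → ℝ) (t : ℕ) : Set Ω :=
  {ω | π.Exploits (t + 1) (runData π θ A ε t ω)}ᶜ ∩
    {ω | mix θ (runData π θ A ε t ω) < max ((localTime (runData π θ A ε t ω) : ℝ) ^ 2) 1}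

/-- Regret of action `x` in round `t + 1` on the event that the confidence set is correct; in
exploration rounds, `q` times the potential is subtracted. -/
def goodRegret (π : IDS X M κ) (θ : Vec d) (A : ℕ → Ω → Vec d) (ε : ℕ → Ω → ℝ) (x₀ : Vec d)
    (q : ℝ) (t : ℕ) (x : Vec d) (ω : Ω) : ℝ :=
  (goodExploit π θ A ε t).indicator (fun _ => (inner ℝ (x₀ - x) θ : ℝ)) ω +
    (goodExplore π θ A ε t).indicator (fun ω => (inner ℝ (x₀ - x) θ : ℝ) -
      q * wnorm (cov (runData π θ A ε t ω))⁻¹ x ^ 2) ω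

theorem disjoint_good (t : ℕ) {ω : Ω} (h : ω ∈ goodExploit π θ A ε t) :
    ω ∉ goodExplore π θ A ε t := fun h' => h'.1 h.1

/-- The number `B` bounds both `beta` and all minimal costs. The coefficient of the potential is
`(2K + b)/c` from `sum_mu_regret_le`, with `b = B` and `K` from `infoGain_le`. Good exploitation
contributes at most 0. -/
theorem sum_actionLaw_goodRegret_le (hM : IsCompact M) (hθ : ‖θ‖ ≤ 1) (hθM : θ ∈ M) {x₀ : Vec d}
    (hx₀ : x₀ ∈ X) {L : ℝ} {n : ℕ} (hn : 2 ≤ n) (hd : 1 ≤ d) {ω : Ω} (hA : ∀ i, ‖A i ω‖ ≤ L)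
    {t : ℕ} (ht : t < n) {B c : ℝ} (hB : (14 + 4 * L ^ 2) * (d * Real.log n) = B) (hc : 0 < c) :
    ∑ x : X, π.actionLaw (t + 1) (runData π θ A ε t ω) x *
      goodRegret π θ A ε x₀ ((2 * (2 * (B + |κ| * (2 + B)) + B) + B) / c) t x ω ≤ c / 2 := by
  classical
  set q := (2 * (2 * (B + |κ| * (2 + B)) + B) + B) / c with hq
  by_cases h1 : ω ∈ goodExploit π θ A ε t
  · have hex : π.Exploits (t + 1) (runData π θ A ε t ω) := h1.1
    have h2 : ∀ x : X, goodRegret π θ A ε x₀ q t x ω = inner ℝ (x₀ - x) θ := fun x => by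
      rw [goodRegret, Set.indicator_of_mem h1, Set.indicator_of_notMem (disjoint_good t h1), add_zero]
    have h3 : π.actionLaw (t + 1) (runData π θ A ε t ω) =
        Pi.single (π.xHat (runData π θ A ε t ω)) 1 := by
      rw [IDS.actionLaw, if_pos hex]
    simp_rw [h2, h3]
    rw [Finset.sum_eq_single (π.xHat (runData π θ A ε t ω)) (fun y _ hy => by simp [hy]) (by simp)]
    rw [Pi.single_eq_same, one_mul, inner_sub_left]
    linarith [inner_le_of_exploits hM hθ hθM hex h1.2 hx₀]
  by_cases h2 : ω ∈ goodExplore π θ A ε t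
  · have hex : ¬π.Exploits (t + 1) (runData π θ A ε t ω) := h2.1
    have h3 : ∀ x : X, goodRegret π θ A ε x₀ q t x ω = inner ℝ (x₀ - x) θ -
        q * wnorm (cov (runData π θ A ε t ω))⁻¹ (x : Vec d) ^ 2 := fun x => by
      rw [goodRegret, Set.indicator_of_notMem h1, Set.indicator_of_mem h2, zero_add]
    have h4 : π.actionLaw (t + 1) (runData π θ A ε t ω) = π.mu (runData π θ A ε t ω) := by
      rw [IDS.actionLaw, if_neg hex]
    simp_rw [h3, h4]
    have hne := alts_nonempty_of_not_exploits hex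
    have hb : beta (runData π θ A ε t ω) ((localTime (runData π θ A ε t ω) : ℝ) ^ 2) ≤ B := by
      rw [← hB]
      refine beta_le hn hd (norm_le_of_mem_runData hA t) ((length_runData_le t ω).trans ht.le) ?_
      have : localTime (runData π θ A ε t ω) ≤ n := by
        have := length_runData_le (π := π) (θ := θ) (A := A) (ε := ε) t ω
        unfold localTime
        omega
      gcongr
    refine sum_mu_regret_le hθ hne h2.2 hx₀ (fun y => ?_) hb hc
    refine (infoGain_le hne (B := B) ?_ y).trans
      (mul_le_mul_of_nonneg_right (by linarith) (sq_nonneg _))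
    rw [← hB]
    exact minCost_take_le hn hd hA ht hex
  · have h3 : ∀ x : X, goodRegret π θ A ε x₀ q t x ω = 0 := fun x => by
      rw [goodRegret, Set.indicator_of_notMem h1, Set.indicator_of_notMem h2, add_zero]
    simp only [h3, mul_zero, Finset.sum_const_zero]
    positivity

open Classical in
/-- Pathwise decomposition of the regret of one round. -/
theorem inner_sub_action_le (x₀ : Vec d) {q : ℝ} (hq : 0 ≤ q) (t : ℕ) (ω : Ω)
    (h1 : (inner ℝ (x₀ - A t ω) θ : ℝ) ≤ 1) :
    (inner ℝ (x₀ - A t ω) θ : ℝ) ≤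
      {ω | max (((t + 1 : ℕ) : ℝ) * Real.log (t + 1 : ℕ)) 1 ≤
        mix θ (runData π θ A ε t ω)}.indicator (fun _ => (1 : ℝ)) ω +
      (if π.Exploits (t + 1) (runData π θ A ε t ω) then 0 else
        if (localTime (runData π θ A ε t ω) : ℝ) ^ 2 ≤ mix θ (runData π θ A ε t ω)
        then 1 else 0) +
      goodRegret π θ A ε x₀ q t (A t ω) ω +
      q * (if π.Exploits (t + 1) (runData π θ A ε t ω) then 0 else
        wnorm (cov (runData π θ A ε t ω))⁻¹ (A t ω) ^ 2) := by
  have hpot : 0 ≤ q * wnorm (cov (runData π θ A ε t ω))⁻¹ (A t ω) ^ 2 := by positivity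
  have hind : 0 ≤ {ω | max (((t + 1 : ℕ) : ℝ) * Real.log (t + 1 : ℕ)) 1 ≤
        mix θ (runData π θ A ε t ω)}.indicator (fun _ => (1 : ℝ)) ω :=
    Set.indicator_nonneg (fun _ _ => zero_le_one) _
  by_cases hex : π.Exploits (t + 1) (runData π θ A ε t ω)
  · have hn : ω ∉ goodExplore π θ A ε t := fun h => h.1 hex
    rw [if_pos hex, if_pos hex, goodRegret, Set.indicator_of_notMem hn, mul_zero, add_zero, add_zero,
      add_zero]
    by_cases hg : ω ∈ goodExploit π θ A ε t
    · rw [Set.indicator_of_mem hg]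
      linarith
    · have hm : ω ∈ {ω | max (((t + 1 : ℕ) : ℝ) * Real.log (t + 1 : ℕ)) 1 ≤
          mix θ (runData π θ A ε t ω)} := by
        by_contra h
        rw [Set.mem_ofPred_eq, not_le] at h
        exact hg ⟨hex, h⟩
      rw [Set.indicator_of_notMem hg, Set.indicator_of_mem hm]
      linarith
  · have hn : ω ∉ goodExploit π θ A ε t := fun h => hex h.1
    rw [if_neg hex, if_neg hex, goodRegret, Set.indicator_of_notMem hn, zero_add]
    by_cases hg : ω ∈ goodExplore π θ A ε t
    · rw [Set.indicator_of_mem hg]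
      have : (0 : ℝ) ≤ if (localTime (runData π θ A ε t ω) : ℝ) ^ 2 ≤ mix θ (runData π θ A ε t ω)
        then 1 else 0 := by split_ifs <;> norm_num
      linarith
    · have hm : max ((localTime (runData π θ A ε t ω) : ℝ) ^ 2) 1 ≤ mix θ (runData π θ A ε t ω) :=
        not_lt.1 fun h => hg ⟨hex, h⟩
      rw [Set.indicator_of_notMem hg, if_pos ((le_max_left _ _).trans hm)]
      linarith

open Classical in
-- Counting by local time makes each level deterministic: prefix `j` of the final data is tested at
-- `(j + 1)²`, so Markov's inequality applies for fixed `j`.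
theorem sum_explore_failure_le (n : ℕ) (ω : Ω) :
    ∑ t ∈ Finset.range n, (if π.Exploits (t + 1) (runData π θ A ε t ω) then 0 else
        if (localTime (runData π θ A ε t ω) : ℝ) ^ 2 ≤ mix θ (runData π θ A ε t ω)
        then (1 : ℝ) else 0) ≤
      ∑ j ∈ Finset.range n, {ω | ((j + 1 : ℕ) : ℝ) ^ 2 ≤
        mix θ ((runData π θ A ε n ω).take j)}.indicator (fun _ => (1 : ℝ)) ω := by
  rw [sum_explore_eq (fun D => if (localTime D : ℝ) ^ 2 ≤ mix θ D then (1 : ℝ) else 0)]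
  have hlen := length_runData_le (π := π) (θ := θ) (A := A) (ε := ε) n ω
  calc _ = ∑ j ∈ Finset.range (runData π θ A ε n ω).length, {ω | ((j + 1 : ℕ) : ℝ) ^ 2 ≤
        mix θ ((runData π θ A ε n ω).take j)}.indicator (fun _ => (1 : ℝ)) ω := by
        refine Finset.sum_congr rfl fun j hj => ?_
        have h : localTime ((runData π θ A ε n ω).take j) = j + 1 := by
          rw [localTime, List.length_take, min_eq_left (Finset.mem_range.1 hj).le]
        rw [h, Set.indicator_apply]
        rfl
    _ ≤ _ := Finset.sum_le_sum_of_subset_of_nonneg (Finset.range_mono hlen) fun j _ _ =>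
        Set.indicator_nonneg (fun _ _ => zero_le_one) _

/-- Number of failures of the confidence sets used in the first `n` rounds. -/
def failureCount (π : IDS X M κ) (θ : Vec d) (A : ℕ → Ω → Vec d) (ε : ℕ → Ω → ℝ) (n : ℕ) (ω : Ω) :
    ℝ :=
  (∑ t ∈ Finset.range n, {ω | max (((t + 1 : ℕ) : ℝ) * Real.log (t + 1 : ℕ)) 1 ≤
      mix θ (runData π θ A ε t ω)}.indicator (fun _ => (1 : ℝ)) ω) +
    ∑ j ∈ Finset.range n, {ω | ((j + 1 : ℕ) : ℝ) ^ 2 ≤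
      mix θ ((runData π θ A ε n ω).take j)}.indicator (fun _ => (1 : ℝ)) ω

variable [m0 : MeasurableSpace Ω] {P : Measure Ω} [IsProbabilityMeasure P]

theorem IsRun.integral_goodRegret_le (hr : IsRun π θ P A ε) (hM : IsCompact M) (hθ : ‖θ‖ ≤ 1)
    (hθM : θ ∈ M) (hX : Metric.diam (X : Set (Vec d)) ≤ 1) {x₀ : Vec d} (hx₀ : x₀ ∈ X) {L : ℝ}
    (hL : ∀ x ∈ X, ‖x‖ ≤ L) {n : ℕ} (hn : 2 ≤ n) (hd : 1 ≤ d) {t : ℕ} (ht : t < n) {B c : ℝ}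
    (hB : (14 + 4 * L ^ 2) * (d * Real.log n) = B) (hc : 0 < c) :
    Integrable (fun ω => goodRegret π θ A ε x₀
      ((2 * (2 * (B + |κ| * (2 + B)) + B) + B) / c) t (A t ω) ω) P ∧
    ∫ ω, goodRegret π θ A ε x₀
      ((2 * (2 * (B + |κ| * (2 + B)) + B) + B) / c) t (A t ω) ω ∂P ≤ c / 2 := by
  classical
  set q := (2 * (2 * (B + |κ| * (2 + B)) + B) + B) / c with hq
  have hstat := hr.statMeasurable hM t
  have hex := hr.measurableSet_exploits hM t
  have hlt : Measurable[hist θ A ε t] fun ω => (localTime (runData π θ A ε t ω) : ℝ) :=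
    (measurable_from_top (f := fun n : ℕ => ((n + 1 : ℕ) : ℝ))).comp hstat.length
  have hS1 : MeasurableSet[hist θ A ε t] (goodExploit π θ A ε t) :=
    hex.inter (measurableSet_lt hstat.mix measurable_const)
  have hS2 : MeasurableSet[hist θ A ε t] (goodExplore π θ A ε t) :=
    hex.compl.inter (measurableSet_lt hstat.mix ((hlt.pow_const 2).max measurable_const))
  refine hr.integral_action_le t (b := 1 + (1 + |q| * L ^ 2)) (fun x _ => ?_) (fun x hx ω => ?_) ?_
  · exact (measurable_const.indicator hS1).add (Measurable.indicator (measurable_const.sub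
      (((StatMeasurable.wnorm hstat.covInv measurable_const).pow_const 2).const_mul q)) hS2)
  · have h1 := abs_inner_sub_le_one hX hθ hx₀ hx
    have h2 : |q * wnorm (cov (runData π θ A ε t ω))⁻¹ x ^ 2| ≤ |q| * L ^ 2 := by
      rw [abs_mul, abs_of_nonneg (sq_nonneg (wnorm _ x))]
      have h3 := (wnorm_inv_le_norm (cov_posDef (runData π θ A ε t ω))
        (cov_sub_one_posSemidef _) x).trans (hL x hx)
      exact mul_le_mul_of_nonneg_left (pow_le_pow_left₀ (wnorm_nonneg _ _) h3 2) (abs_nonneg _)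
    refine (abs_add_le _ _).trans (add_le_add ?_ ?_)
    · rw [Set.indicator_apply]
      split_ifs
      · exact h1
      · simp
    · rw [Set.indicator_apply]
      split_ifs
      · exact (abs_sub _ _).trans (add_le_add h1 h2)
      · rw [abs_zero]
        positivity
  · have hAll := ae_all_iff.2 fun i => hr.ae_action_mem i
    filter_upwards [hAll] with ω hω
    exact sum_actionLaw_goodRegret_le hM hθ hθM hx₀ hn hd (fun i => hL _ (hω i)) ht hB hc

/-- The failure probabilities are at most `2/(t + 1)` by rounds and `1/(j + 1)² ≤ 1/(j + 1)` by
local time. The sum is at most `3(1 + log n) ≤ 9 log n`, since `log n ≥ 1/2`. -/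
theorem IsRun.integral_failureCount_le (hr : IsRun π θ P A ε) (hM : IsCompact M) {n : ℕ}
    (hn : 2 ≤ n) : Integrable (failureCount π θ A ε n) P ∧
      ∫ ω, failureCount π θ A ε n ω ∂P ≤ 9 * Real.log n := by
  have hm : ∀ t j, Measurable fun ω => mix θ ((runData π θ A ε t ω).take j) := fun t j =>
    ((hr.statMeasurable_take hM t j).mono (hr.hist_le t)).mix
  have hm' : ∀ t, Measurable fun ω => mix θ (runData π θ A ε t ω) := fun t =>
    ((hr.statMeasurable hM t).mono (hr.hist_le t)).mix
  have hs1 : ∀ t : ℕ, MeasurableSet {ω | max (((t + 1 : ℕ) : ℝ) * Real.log (t + 1 : ℕ)) 1 ≤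
      mix θ (runData π θ A ε t ω)} := fun t => measurableSet_le measurable_const (hm' t)
  have hs2 : ∀ j : ℕ, MeasurableSet {ω | ((j + 1 : ℕ) : ℝ) ^ 2 ≤
      mix θ ((runData π θ A ε n ω).take j)} := fun j => measurableSet_le measurable_const (hm n j)
  have hi1 := fun t => (integrable_const (μ := P) (1 : ℝ)).indicator (hs1 t)
  have hi2 := fun j => (integrable_const (μ := P) (1 : ℝ)).indicator (hs2 j)
  have hI1 := integrable_finsetSum (Finset.range n) fun t _ => hi1 t
  have hI2 := integrable_finsetSum (Finset.range n) fun j _ => hi2 j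
  refine ⟨hI1.add hI2, ?_⟩
  simp only [failureCount]
  rw [integral_add hI1 hI2, integral_finsetSum _ fun t _ => hi1 t,
    integral_finsetSum _ fun j _ => hi2 j, ← Finset.sum_add_distrib]
  have hterm : ∀ t : ℕ,
      ∫ ω, {ω | max (((t + 1 : ℕ) : ℝ) * Real.log (t + 1 : ℕ)) 1 ≤
        mix θ (runData π θ A ε t ω)}.indicator (fun _ => (1 : ℝ)) ω ∂P +
      ∫ ω, {ω | ((t + 1 : ℕ) : ℝ) ^ 2 ≤
        mix θ ((runData π θ A ε n ω).take t)}.indicator (fun _ => (1 : ℝ)) ω ∂P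
      ≤ 3 * ((t + 1 : ℕ) : ℝ)⁻¹ := fun t => by
    rw [integral_indicator_const _ (hs1 t), integral_indicator_const _ (hs2 t), smul_eq_mul,
      smul_eq_mul, mul_one, mul_one]
    have hpos : (0 : ℝ) < ((t + 1 : ℕ) : ℝ) := by positivity
    have h1 : P.real {ω | max (((t + 1 : ℕ) : ℝ) * Real.log (t + 1 : ℕ)) 1 ≤
        mix θ (runData π θ A ε t ω)} ≤ 2 * ((t + 1 : ℕ) : ℝ)⁻¹ := by
      have hc : 0 < max (((t + 1 : ℕ) : ℝ) * Real.log (t + 1 : ℕ)) 1 :=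
        lt_max_of_lt_right one_pos
      have h2 := hr.measureReal_mix_take_ge_le hM t t hc
      simp_rw [List.take_of_length_le (length_runData_le t _)] at h2
      refine h2.trans ?_
      rw [div_le_iff₀ hc, mul_comm (2 : ℝ), mul_assoc, ← div_eq_inv_mul, le_div_iff₀ hpos, one_mul]
      rcases Nat.eq_zero_or_pos t with rfl | htpos
      -- In round 1 the level `t log t` is zero and only the floor 1 acts.
      · have := le_max_right (((0 + 1 : ℕ) : ℝ) * Real.log (0 + 1 : ℕ)) 1
        push_cast at this ⊢
        linarith
      · have h3 := one_half_le_log (n := t + 1) (by omega)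
        have h4 := le_max_left (((t + 1 : ℕ) : ℝ) * Real.log (t + 1 : ℕ)) 1
        nlinarith
    have h2 : P.real {ω | ((t + 1 : ℕ) : ℝ) ^ 2 ≤ mix θ ((runData π θ A ε n ω).take t)} ≤
        ((t + 1 : ℕ) : ℝ)⁻¹ := by
      refine (hr.measureReal_mix_take_ge_le hM t n (pow_pos hpos 2)).trans ?_
      rw [one_div]
      refine inv_anti₀ hpos ?_
      have : (1 : ℝ) ≤ ((t + 1 : ℕ) : ℝ) := by exact_mod_cast Nat.succ_le_succ t.zero_le
      nlinarith
    linarith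
  refine (Finset.sum_le_sum fun t _ => hterm t).trans ?_
  rw [← Finset.mul_sum]
  have hh := harmonic_le_one_add_log n
  rw [harmonic] at hh
  push_cast at hh ⊢
  have hlog := one_half_le_log hn
  linarith

/-- Regret bound with explicit constant. -/
theorem IsRun.integral_pathRegret_le (hr : IsRun π θ P A ε) (hM : IsCompact M) (hθ : ‖θ‖ ≤ 1)
    (hθM : θ ∈ M) (hX : Metric.diam (X : Set (Vec d)) ≤ 1) {L : ℝ} (hL : ∀ x ∈ X, ‖x‖ ≤ L) {n : ℕ}
    (hn : 2 ≤ n) (hd : 1 ≤ d) :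
    Integrable (pathRegret X θ A n) P ∧
      ∫ ω, pathRegret X θ A n ω ∂P ≤
        (10 + (8 + 4 * |κ|) * (18 + 4 * L ^ 2) * ((1 + L ^ 2) * (1 + 2 * L ^ 2))) *
          (d * Real.sqrt n * Real.log n) := by
  classical
  obtain ⟨x₀, hx₀, hmax⟩ := Finset.exists_max_image X (fun x => (inner ℝ x θ : ℝ))
    ⟨_, (π.xHat []).2⟩
  have hlog := one_half_le_log hn
  have hd' : (1 : ℝ) ≤ d := by exact_mod_cast hd
  have hn0 : (1 : ℝ) ≤ n := by exact_mod_cast (by omega : 1 ≤ n)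
  have hsq : 1 ≤ Real.sqrt n := by rw [Real.one_le_sqrt]; exact hn0
  have hsqn : Real.sqrt n * Real.sqrt n = n := Real.mul_self_sqrt (by linarith)
  set ℓ := d * Real.log n with hℓ
  have hℓ1 : 1 / 2 ≤ ℓ := by nlinarith
  have hℓ2 : Real.log n ≤ ℓ := le_mul_of_one_le_left (by linarith) hd'
  -- The choice `c = ℓ/√n` balances `n c/2` against `(B/c) ℓ`; both are of order `√n ℓ`.
  have hc : 0 < ℓ / Real.sqrt n := by positivity
  set B := (14 + 4 * L ^ 2) * ℓ with hB
  have hB0 : 0 ≤ B := by positivity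
  set q := (2 * (2 * (B + |κ| * (2 + B)) + B) + B) / (ℓ / Real.sqrt n) with hq
  have hq0 : 0 ≤ q := by positivity
  have hreg : pathRegret X θ A n = fun ω =>
      ∑ t ∈ Finset.range n, (inner ℝ (x₀ - A t ω) θ : ℝ) := by
    ext ω
    exact pathRegret_eq hx₀ hmax n ω
  have hAll := ae_all_iff.2 fun i => hr.ae_action_mem i
  have hint : Integrable (pathRegret X θ A n) P := by
    rw [hreg]
    refine integrable_finsetSum _ fun t _ => Integrable.of_bound (C := 1) ?_ ?_
    · exact ((measurable_const.sub (hr.measurable_action t)).inner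
        measurable_const).aestronglyMeasurable
    · filter_upwards [hAll] with ω hω
      exact abs_inner_sub_le_one hX hθ hx₀ (hω t)
  refine ⟨hint, ?_⟩
  have hgood := fun t (ht : t ∈ Finset.range n) => hr.integral_goodRegret_le hM hθ hθM hX hx₀ hL
    hn hd (Finset.mem_range.1 ht) hB.symm hc
  obtain ⟨hFi, hFb⟩ := hr.integral_failureCount_le hM hn
  have hGi := integrable_finsetSum (Finset.range n) fun t ht => (hgood t ht).1
  have hGb : ∫ ω, ∑ t ∈ Finset.range n, goodRegret π θ A ε x₀ q t (A t ω) ω ∂P ≤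
      Real.sqrt n * ℓ := by
    rw [integral_finsetSum _ fun t ht => (hgood t ht).1]
    refine (Finset.sum_le_sum fun t ht => (hgood t ht).2).trans ?_
    rw [Finset.sum_const, Finset.card_range, nsmul_eq_mul]
    have h1 : (n : ℝ) * (ℓ / Real.sqrt n / 2) = Real.sqrt n * ℓ / 2 := by
      nth_rewrite 1 [← hsqn]
      field_simp
    rw [h1]
    nlinarith
  have hpath : ∀ᵐ ω ∂P, pathRegret X θ A n ω ≤ failureCount π θ A ε n ω +
      ∑ t ∈ Finset.range n, goodRegret π θ A ε x₀ q t (A t ω) ω +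
        q * ((1 + L ^ 2) * ((1 + 2 * L ^ 2) * ℓ)) := by
    filter_upwards [hAll] with ω hω
    have hAL : ∀ i, ‖A i ω‖ ≤ L := fun i => hL _ (hω i)
    rw [hreg]
    have h1 := Finset.sum_le_sum fun t (_ : t ∈ Finset.range n) =>
      inner_sub_action_le (π := π) (ε := ε) x₀ hq0 t ω
        (abs_le.1 (abs_inner_sub_le_one hX hθ hx₀ (hω t))).2
    rw [Finset.sum_add_distrib, Finset.sum_add_distrib, Finset.sum_add_distrib,
      ← Finset.mul_sum] at h1
    have h2 := sum_explore_failure_le (π := π) (θ := θ) (A := A) (ε := ε) n ω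
    have h3 := sum_potential_le (π := π) (θ := θ) (ε := ε) hAL n
    have h4 := log_det_cov_le hn (norm_le_of_mem_runData (π := π) (θ := θ) (ε := ε) hAL n)
      (length_runData_le n ω)
    have h5 := mul_le_mul_of_nonneg_left (h3.trans (mul_le_mul_of_nonneg_left h4
      (by positivity : (0 : ℝ) ≤ 1 + L ^ 2))) hq0
    unfold failureCount
    linarith
  have hmono : ∫ ω, pathRegret X θ A n ω ∂P ≤ ∫ ω, failureCount π θ A ε n ω ∂P +
      ∫ ω, ∑ t ∈ Finset.range n, goodRegret π θ A ε x₀ q t (A t ω) ω ∂P +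
        q * ((1 + L ^ 2) * ((1 + 2 * L ^ 2) * ℓ)) := by
    refine (integral_mono_ae hint ((hFi.add hGi).add (integrable_const _)) hpath).trans_eq ?_
    rw [integral_add' (hFi.add hGi) (integrable_const _), integral_add' hFi hGi, integral_const,
      probReal_univ, one_smul]
  -- The numerator of `q` is `7B + 4|κ|(2 + B) ≤ (8 + 4|κ|)(2 + B)`, and `2 ≤ 4ℓ` turns 14 into 18.
  have hqle : q ≤ (8 + 4 * |κ|) * (18 + 4 * L ^ 2) * Real.sqrt n := by
    rw [hq, div_le_iff₀ hc]
    have h1 : (8 + 4 * |κ|) * (18 + 4 * L ^ 2) * Real.sqrt n * (ℓ / Real.sqrt n)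
        = (8 + 4 * |κ|) * ((18 + 4 * L ^ 2) * ℓ) := by field_simp
    rw [h1]
    have h2 : 2 + B ≤ (18 + 4 * L ^ 2) * ℓ := by rw [hB]; nlinarith
    have h3 := mul_le_mul_of_nonneg_left h2 (abs_nonneg κ)
    nlinarith
  have hqfin : q * ((1 + L ^ 2) * ((1 + 2 * L ^ 2) * ℓ)) ≤
      (8 + 4 * |κ|) * (18 + 4 * L ^ 2) * Real.sqrt n * ((1 + L ^ 2) * ((1 + 2 * L ^ 2) * ℓ)) :=
    mul_le_mul_of_nonneg_right hqle (by positivity)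
  have hfail : 9 * Real.log n ≤ 9 * (Real.sqrt n * ℓ) := by nlinarith
  -- The 10 is 9 from the failures plus 1 from the good rounds; the rest is the potential term.
  have hfinal : (10 + (8 + 4 * |κ|) * (18 + 4 * L ^ 2) * ((1 + L ^ 2) * (1 + 2 * L ^ 2))) *
      (d * Real.sqrt n * Real.log n) = 9 * (Real.sqrt n * ℓ) + Real.sqrt n * ℓ +
      (8 + 4 * |κ|) * (18 + 4 * L ^ 2) * Real.sqrt n * ((1 + L ^ 2) * ((1 + 2 * L ^ 2) * ℓ)) := by
    rw [hℓ]
    ring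
  rw [hfinal]
  linarith

end Regret

end LinBandit

end

open LinBandit
theorem theorem1 (κ L : ℝ) :
    ∃ C : ℝ, ∀ (d : ℕ) (X : Finset (Vec d)) (M : Set (Vec d)) (θ : Vec d),
      Submodule.span ℝ (X : Set (Vec d)) = ⊤ →
      Metric.diam (X : Set (Vec d)) ≤ 1 →
      (∀ x ∈ X, ‖x‖ ≤ L) →
      (∃ F : Finset (Vec d), M = convexHull ℝ (F : Set (Vec d))) →
      Metric.diam M ≤ 1 →
      θ ∈ M → ‖θ‖ ≤ 1 →
      ∀ (π : IDS X M κ) (Ω : Type*) [MeasurableSpace Ω] (P : Measure Ω) [IsProbabilityMeasure P]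
        (A : ℕ → Ω → Vec d) (ε : ℕ → Ω → ℝ),
        IsRun π θ P A ε →
        ∀ n : ℕ, 2 ≤ n →
          Integrable (pathRegret X θ A n) P ∧
          ∫ ω, pathRegret X θ A n ω ∂P ≤ C * (d * Real.sqrt n * Real.log n) := by
  refine ⟨10 + (8 + 4 * |κ|) * (18 + 4 * L ^ 2) * ((1 + L ^ 2) * (1 + 2 * L ^ 2)), ?_⟩
  rintro d X M θ - hX hL ⟨F, rfl⟩ - hθM hθ π Ω _ P _ A ε hr n hn
  -- In dimension zero the bound is 0 and all rewards vanish; otherwise `1 ≤ d` absorbs constants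
  -- into `d log n`.
  rcases Nat.eq_zero_or_pos d with rfl | hd
  · have h0 : pathRegret X θ A n = fun _ => 0 := by
      ext ω
      have : ∀ x : Vec 0, (inner ℝ x θ : ℝ) = 0 := fun x => by
        rw [Subsingleton.elim θ 0, inner_zero_right]
      simp [pathRegret, this]
    rw [h0]
    simp
  · exact hr.integral_pathRegret_le (F.finite_toSet.isCompact_convexHull ℝ) hθ hθM hX hL hn hd
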